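/- Let $p$ be a prime and let $\mathfrak G$ be the $p$-adic Vilenkin group: the group of all sequences $x=(x_n)_{n\in\mathbb Z}$, $x_n\in\{0,\dots,p-1\}$, with only finitely many $x_n\neq 0$ for $n<0$, under coordinatewise addition $\dotplus$ modulo $p$ (with inverse operation $\dot-$), with the topology generated by the cosets of the subgroups $\mathfrak G_n=\{x: x_k=0 \text{ for } k<n\}$, $n\in\mathbb Z$. Let $g_n$ be the sequence with $1$ at place $n$ and $0$ elsewhere, let $\mathcal A:\mathfrak G\to\mathfrak G$, $(\mathcal Ax)_n=x_{n+1}$, be the dilation operator, and let $\mu$ be the Haar measure with $\mu(\mathfrak G_0)=1$. Put $H_0^{(s)}=\{a_{-1}g_{-1}\dotplus\cdots\dotplus a_{-s}g_{-s}: 0\le a_j\le p-1\}$ and $H_0=\bigcup_{s\ge1}H_0^{(s)}$. Let $X$ be the group of continuous characters of $\mathfrak G$, written $\chi(x)=(\chi,x)$, let $\mathfrak G_n^\perp\subset X$ be the annihilator of $\mathfrak G_n$, let $\nu$ be the Haar measure on $X$ with $\nu(\mathfrak G_0^\perp)=1$, let $(\chi\mathcal A^k,x)=(\chi,\mathcal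 A^kx)$ for $k\in\mathbb Z$, and let $r_n\in X$ be given by $(r_n,x)=e^{2\pi i x_n/p}$. Let $T$ be a tree with vertex set $\{0,1,\dots,p-1\}$, rooted at $0$, with edges directed away from the root; $(j,i)$ is an edge if $j$ is the parent of $i$. Let $\lambda_{i+jp}\in\mathbb C$ ($0\le i,j\le p-1$) satisfy $\lambda_0=1$, $|\lambda_{i+jp}|=1$ if $(j,i)$ is an edge of $T$, and $\lambda_{i+jp}=0$ for all other pairs. Let the mask $m_0:X\to\mathbb C$ be equal to $\lambda_{i+jp}$ on all cosets $\mathfrak G_{-1}^\perp r_{-1}^{i}r_0^{j}r_1^{\alpha_1}\cdots r_s^{\alpha_s}$ ($s\ge 0$, $0\le\alpha_k\le p-1$), let $$\hat\varphi(\chi)=\prod_{n=0}^\infty m_0(\chi\mathcal A^{-n}),$$ and let $\varphi(x)=\int_X\hat\varphi(\chi)(\chi,x)\,d\nu(\chi)$ be the function with Fourier transform $\hat\varphi$. For $n\in\mathbb Z$ let $V_n$ be the closed linear span in $L_2(\mathfrak G)=L_2(\mathfrak G,\mu)$ of the functions $\varphi(\mathcal A^nx\dot-h)$, $h\in H_0$.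 Then there are unique numbers $\beta_h$, $h\in H_0^{(2)}$, such that $$m_0(\chi)=\frac1p\sum_{h\in H_0^{(2)}}\beta_h\,\overline{(\chi\mathcal A^{-1},h)}\qquad\text{for all }\chi\in X.$$ Put $\beta_h^{(l)}=\beta_h\,(r_0^l,\mathcal A^{-1}h)$ and $$\psi_l(x)=\sum_{h\in H_0^{(2)}}\beta^{(l)}_h\,\varphi(\mathcal Ax\dot-h),\qquad l=1,\dots,p-1.$$ Then $V_0\subset V_1$, and the functions $\psi_l(x\dot-h)$, $l=1,\dots,p-1$, $h\in H_0$, form an orthonormal basis of $W_0=V_1\ominus V_0$, the orthogonal complement of $V_0$ in $V_1$. Consequently, the functions $p^{n/2}\psi_l(\mathcal A^nx\dot-h)$, $l=1,\dots,p-1$, $n\in\mathbb Z$, $h\in H_0$, form an orthonormal basis of $L_2(\mathfrak G)$. -/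

import Mathlib

open MeasureTheory

noncomputable section

namespace VilenkinWavelet

/-! ### The `p`-adic Vilenkin group -/

/-- The two-sided sequences `(x_n)` of residues mod `p` with only finitely many nonzero terms of
negative index, under coordinatewise addition mod `p`. -/
def sequences (p : ℕ) : AddSubgroup (ℤ → ZMod p) where
  carrier := {x | ∃ m : ℤ, ∀ n < m, x n = 0}
  zero_mem' := ⟨0, fun _ _ => rfl⟩
  add_mem' := by
    rintro x y ⟨m, hm⟩ ⟨k, hk⟩
    refine ⟨min m k, fun n hn => ?_⟩
    simp [hm n (lt_of_lt_of_le hn (min_le_left _ _)), hk n (lt_of_lt_of_le hn (min_le_right _ _))]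
  neg_mem' := by
    rintro x ⟨m, hm⟩
    exact ⟨m, fun n hn => by simp [hm n hn]⟩

/-- The `p`-adic Vilenkin group `𝔊`. Its topology is not the product topology (which the subtype
would inherit) but the one generated by the chain of subgroups `chain p n` below. The element `g_n`
of the basic system is the `n`-th unit sequence, so `x = ∑ x_n g_n`. -/
def Vilenkin (p : ℕ) : Type := sequences p

instance (p : ℕ) : AddCommGroup (Vilenkin p) := inferInstanceAs (AddCommGroup (sequences p))

instance (p : ℕ) : CoeFun (Vilenkin p) (fun _ => ℤ → ZMod p) := ⟨fun x => x.1⟩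

theorem Vilenkin.ext {p : ℕ} {x y : Vilenkin p} (h : ∀ n, x n = y n) : x = y :=
  Subtype.ext (funext h)

theorem add_coord {p : ℕ} (x y : Vilenkin p) (n : ℤ) : (x + y) n = x n + y n := rfl

theorem neg_coord {p : ℕ} (x : Vilenkin p) (n : ℤ) : (-x) n = -x n := rfl

theorem zero_coord {p : ℕ} (n : ℤ) : (0 : Vilenkin p) n = 0 := rfl

/-- The subgroup `𝔊_n` of all sequences supported in `[n, ∞)`. -/
def chain (p : ℕ) (n : ℤ) : AddSubgroup (Vilenkin p) where
  carrier := {x | ∀ k < n, x k = 0}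
  zero_mem' := fun _ _ => rfl
  add_mem' := fun {x y} hx hy k hk => by rw [add_coord, hx k hk, hy k hk, add_zero]
  neg_mem' := fun {x} hx k hk => by rw [neg_coord, hx k hk, neg_zero]

theorem chain_anti (p : ℕ) {m n : ℤ} (h : m ≤ n) : chain p n ≤ chain p m :=
  fun _ hx k hk => hx k (lt_of_lt_of_le hk h)

/-- The subgroups `𝔊_n` as a neighbourhood base at zero. -/
abbrev chainBasis (p : ℕ) : AddGroupFilterBasis (Vilenkin p) :=
  addGroupFilterBasisOfComm (Set.range fun n : ℤ => (chain p n : Set (Vilenkin p)))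
    ⟨_, ⟨0, rfl⟩⟩
    (by
      rintro _ _ ⟨m, rfl⟩ ⟨n, rfl⟩
      exact ⟨_, ⟨max m n, rfl⟩, Set.subset_inter
        (chain_anti p (le_max_left m n)) (chain_anti p (le_max_right m n))⟩)
    (by rintro _ ⟨n, rfl⟩; exact (chain p n).zero_mem)
    (by
      rintro _ ⟨n, rfl⟩
      refine ⟨_, ⟨n, rfl⟩, ?_⟩
      rintro _ ⟨x, hx, y, hy, rfl⟩
      exact (chain p n).add_mem hx hy)
    (by
      rintro _ ⟨n, rfl⟩
      exact ⟨_, ⟨n, rfl⟩, fun x hx => (chain p n).neg_mem hx⟩)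

/-- The topology of `𝔊`: the cosets of the `𝔊_n` form a base. -/
instance (p : ℕ) : TopologicalSpace (Vilenkin p) := (chainBasis p).topology

instance (p : ℕ) : IsTopologicalAddGroup (Vilenkin p) := (chainBasis p).isTopologicalAddGroup

theorem chain_mem_nhds (p : ℕ) (n : ℤ) : (chain p n : Set (Vilenkin p)) ∈ nhds 0 :=
  (chainBasis p).mem_nhds_zero ⟨n, rfl⟩

theorem nhds_hasBasis {p : ℕ} (x : Vilenkin p) :
    (nhds x).HasBasis (fun _ : ℤ => True) (fun n => {y | y - x ∈ chain p n}) := by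
  refine ⟨fun t => ?_⟩
  rw [((chainBasis p).nhds_hasBasis x).mem_iff]
  constructor
  · rintro ⟨_, ⟨n, rfl⟩, h⟩
    exact ⟨n, trivial, fun y hy => h ⟨y - x, hy, add_sub_cancel x y⟩⟩
  · rintro ⟨n, -, h⟩
    refine ⟨_, ⟨n, rfl⟩, ?_⟩
    rintro _ ⟨y, hy, rfl⟩
    exact h (by simpa using hy)

theorem isCompact_chain_zero (p : ℕ) [NeZero p] :
    IsCompact (chain p 0 : Set (Vilenkin p)) := by
  let F : (ℕ → ZMod p) → Vilenkin p := fun a =>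
    ⟨fun n => if n < 0 then 0 else a n.toNat, 0, fun n hn => if_pos hn⟩
  have hF : Continuous F := by
    refine continuous_iff_continuousAt.2 fun a => ?_
    refine (nhds_hasBasis (F a)).tendsto_right_iff.2 fun N _ => ?_
    have h : ∀ i ∈ Finset.range N.toNat, ∀ᶠ b : ℕ → ZMod p in nhds a, b i = a i := fun i _ =>
      (continuous_apply i).continuousAt.eventually
        (show {z : ZMod p | z = a i} ∈ nhds (a i) from (isOpen_discrete {a i}).mem_nhds rfl)
    filter_upwards [(Filter.eventually_all_finset _).2 h] with b hb
    intro k hk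
    rw [sub_eq_add_neg, add_coord, neg_coord, ← sub_eq_add_neg, sub_eq_zero]
    change (if k < 0 then 0 else b k.toNat) = if k < 0 then 0 else a k.toNat
    split_ifs with h0
    · rfl
    · exact hb _ (Finset.mem_range.2 (by omega))
  have hR : Set.range F = (chain p 0 : Set (Vilenkin p)) := by
    ext x
    constructor
    · rintro ⟨a, rfl⟩ k hk
      exact if_pos hk
    · intro hx
      refine ⟨fun n => x n, Vilenkin.ext fun n => ?_⟩
      change (if n < 0 then 0 else x (n.toNat : ℤ)) = x n
      split_ifs with h0
      · exact (hx n h0).symm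
      · rw [Int.toNat_of_nonneg (not_lt.1 h0)]
  rw [← hR]
  exact isCompact_range hF

instance (p : ℕ) [NeZero p] : LocallyCompactSpace (Vilenkin p) :=
  (isCompact_chain_zero p).locallyCompactSpace_of_mem_nhds_of_addGroup (chain_mem_nhds p 0)

instance (p : ℕ) : MeasurableSpace (Vilenkin p) := borel _

instance (p : ℕ) : BorelSpace (Vilenkin p) := ⟨rfl⟩

/-- The compact open subgroup `𝔊_0`, as a compact set with nonempty interior. -/
def chainZero (p : ℕ) [NeZero p] : TopologicalSpace.PositiveCompacts (Vilenkin p) where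
  carrier := chain p 0
  isCompact' := isCompact_chain_zero p
  interior_nonempty' := ⟨0, mem_interior_iff_mem_nhds.2 (chain_mem_nhds p 0)⟩

/-- The Haar measure `μ` on `𝔊` with `μ(𝔊_0) = 1`. -/
def mu (p : ℕ) [NeZero p] : Measure (Vilenkin p) := Measure.addHaarMeasure (chainZero p)

/-- The set `H_0` of all finite sums `a_{-1} g_{-1} + ⋯ + a_{-s} g_{-s}`. -/
def H0 (p : ℕ) : Set (Vilenkin p) := {h | ∀ n : ℤ, 0 ≤ n → h n = 0}

/-- The set `H_0^{(s)}` of all sums `a_{-1} g_{-1} + ⋯ + a_{-s} g_{-s}`, for fixed `s`. -/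
def H0s (p s : ℕ) : Set (Vilenkin p) := {h | ∀ n : ℤ, (0 ≤ n ∨ n < -(s : ℤ)) → h n = 0}

instance (p s : ℕ) [NeZero p] : Finite (H0s p s) := by
  refine Finite.of_injective
    (fun (h : H0s p s) (i : Fin s) => (h : Vilenkin p) (-((i : ℕ) : ℤ) - 1)) fun h k hk => ?_
  refine Subtype.ext (Vilenkin.ext fun n => ?_)
  by_cases hn : 0 ≤ n ∨ n < -(s : ℤ)
  · rw [h.2 n hn, k.2 n hn]
  · have := congrFun hk ⟨(-n - 1).toNat, by omega⟩
    have e : (-(((-n - 1).toNat : ℕ) : ℤ) - 1) = n := by omega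
    simpa only [e] using this

instance (p s : ℕ) [NeZero p] : Fintype (H0s p s) := Fintype.ofFinite _

/-- The `k`-th power `𝒜^k`, `k ∈ ℤ`, of the dilation operator
`𝒜 : ∑ a_n g_n ↦ ∑ a_n g_{n-1}`. In coordinates `(𝒜 x)_n = x_{n+1}`. -/
def dil {p : ℕ} (k : ℤ) : Vilenkin p →+ Vilenkin p where
  toFun x := ⟨fun n => x (n + k), by
    obtain ⟨m, hm⟩ := x.2
    exact ⟨m - k, fun n hn => hm _ (by omega)⟩⟩
  map_zero' := rfl
  map_add' _ _ := rfl

theorem dil_coord {p : ℕ} (k : ℤ) (x : Vilenkin p) (n : ℤ) : dil k x n = x (n + k) := rfl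

theorem continuous_dil {p : ℕ} (k : ℤ) : Continuous (dil k : Vilenkin p → Vilenkin p) := by
  refine continuous_of_continuousAt_zero (dil k) ?_
  refine ((nhds_hasBasis (0 : Vilenkin p)).tendsto_iff (nhds_hasBasis _)).2
    fun n _ => ⟨n + k, trivial, fun x hx => ?_⟩
  rw [Set.mem_ofPred_eq, sub_zero] at hx
  rw [Set.mem_ofPred_eq, map_zero, sub_zero]
  exact fun j hj => hx _ (by omega)

/-! ### Characters -/

/-- The group `X` of (continuous) characters of `𝔊`, with the compact-open topology. -/
abbrev X (p : ℕ) : Type := PontryaginDual (Multiplicative (Vilenkin p))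

instance (p : ℕ) : MeasurableSpace (X p) := borel _

instance (p : ℕ) : BorelSpace (X p) := ⟨rfl⟩

/-- The value `(χ, x)` of the character `χ` at `x`. -/
def pairing {p : ℕ} (χ : X p) (x : Vilenkin p) : ℂ := (χ (Multiplicative.ofAdd x) : Circle)

/-- The annihilator `𝔊_n^⊥`. -/
def annihilator (p : ℕ) (n : ℤ) : Subgroup (X p) where
  carrier := {χ | ∀ x ∈ chain p n, pairing χ x = 1}
  one_mem' := fun x _ => by simp [pairing]
  mul_mem' := fun {χ ξ} hχ hξ x hx => by
    have h1 := hχ x hx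
    have h2 := hξ x hx
    simp only [pairing] at h1 h2 ⊢
    change ((χ (Multiplicative.ofAdd x) * ξ (Multiplicative.ofAdd x) : Circle) : ℂ) = 1
    rw [Circle.coe_mul, h1, h2, one_mul]
  inv_mem' := fun {χ} hχ x hx => by
    have h1 := hχ x hx
    simp only [pairing] at h1 ⊢
    change (((χ (Multiplicative.ofAdd x))⁻¹ : Circle) : ℂ) = 1
    rw [Circle.coe_inv, h1, inv_one]

/-- The Haar measure `ν` on `X` with `ν(𝔊_0^⊥) = 1`. -/
def nu (p : ℕ) [NeZero p] : Measure (X p) :=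
  ((Measure.haar : Measure (X p)) (annihilator p 0))⁻¹ • Measure.haar

/-- The character `χ𝒜^k`, given by `(χ𝒜^k, x) = (χ, 𝒜^k x)`. -/
def dilChar {p : ℕ} (k : ℤ) (χ : X p) : X p :=
  PontryaginDual.map
    ({ toFun := fun x => Multiplicative.ofAdd (dil k x.toAdd)
       map_one' := by simp
       map_mul' := fun x y => by simp
       continuous_toFun := continuous_ofAdd.comp ((continuous_dil k).comp continuous_toAdd) } :
      Multiplicative (Vilenkin p) →ₜ* Multiplicative (Vilenkin p)) χ

theorem pairing_dilChar {p : ℕ} (k : ℤ) (χ : X p) (x : Vilenkin p) :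
    pairing (dilChar k χ) x = pairing χ (dil k x) := rfl

theorem continuous_coord {p : ℕ} (n : ℤ) : Continuous fun x : Vilenkin p => x n := by
  refine continuous_iff_continuousAt.2 fun x => ?_
  refine tendsto_nhds_of_eventually_eq ?_
  refine (nhds_hasBasis x).eventually_iff.2 ⟨n + 1, trivial, fun y hy => ?_⟩
  have := hy n (by omega)
  rwa [sub_eq_add_neg, add_coord, neg_coord, ← sub_eq_add_neg, sub_eq_zero] at this

/-- The Rademacher function `r_n`, with `(r_n, ∑ a_k g_k) = exp(2πi a_n / p)`. -/
def rademacher (p : ℕ) [NeZero p] (n : ℤ) : X p :=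
  ({ toFun := fun x => ZMod.toCircle (x.toAdd n)
     map_one' := by
       change ZMod.toCircle ((0 : Vilenkin p) n) = 1
       rw [zero_coord, AddChar.map_zero_eq_one]
     map_mul' := fun x y => by
       rw [toAdd_mul, add_coord, AddChar.map_add_eq_mul]
     continuous_toFun := (continuous_of_discreteTopology (f := (ZMod.toCircle : ZMod p → Circle))).comp
       ((continuous_coord n).comp continuous_toAdd) } : Multiplicative (Vilenkin p) →ₜ* Circle)

theorem pairing_rademacher (p : ℕ) [NeZero p] (n : ℤ) (x : Vilenkin p) :
    pairing (rademacher p n) x = Complex.exp (2 * Real.pi * Complex.I * (x n).val / p) :=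
  ZMod.toCircle_apply (x n)

/-! ### Trees, masks, the refinable function and the wavelets -/

/-- `(j, i)` is an edge of the tree `T` rooted at `0`, directed away from the root:
`j` is the parent of `i`. The vertices `0, …, p - 1` are the residues mod `p`. -/
def IsTreeEdge {p : ℕ} (T : SimpleGraph (ZMod p)) (j i : ZMod p) : Prop :=
  T.Adj j i ∧ T.dist 0 i = T.dist 0 j + 1

/-- `lam i j` stands for `λ_{i + jp}`: `λ_0 = 1`, `|λ_{i + jp}| = 1` if `(j, i)` is an edge of the
rooted tree, and `λ_{i + jp} = 0` for all other pairs. -/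
structure IsTreeSequence {p : ℕ} (T : SimpleGraph (ZMod p)) (lam : ZMod p → ZMod p → ℂ) :
    Prop where
  zero : lam 0 0 = 1
  edge : ∀ i j, IsTreeEdge T j i → ‖lam i j‖ = 1
  other : ∀ i j, ¬ IsTreeEdge T j i → (i, j) ≠ (0, 0) → lam i j = 0

/-- The union of all cosets `𝔊_{-1}^⊥ r_{-1}^i r_0^j r_1^{α_1} ⋯ r_s^{α_s}`, `s ≥ 0`: the periodic
extension of the coset `𝔊_{-1}^⊥ r_{-1}^i r_0^j`. -/
def periodicCoset (p : ℕ) [NeZero p] (i j : ZMod p) : Set (X p) :=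
  {χ | ∃ ζ ∈ annihilator p (-1), ∃ (s : ℕ) (α : ℕ → ℕ),
    χ = ζ * rademacher p (-1) ^ i.val * rademacher p 0 ^ j.val *
      ∏ k ∈ Finset.Icc 1 s, rademacher p k ^ α k}

open Classical in
/-- The mask `m_0`: it equals `λ_{i + jp}` on `𝔊_{-1}^⊥ r_{-1}^i r_0^j` and is extended to `X`
periodically, with all periods `r_1^{α_1} ⋯ r_s^{α_s}`. -/
def mask {p : ℕ} [NeZero p] (lam : ZMod p → ZMod p → ℂ) (χ : X p) : ℂ :=
  ∑ i, ∑ j, if χ ∈ periodicCoset p i j then lam i j else 0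

/-- `φ̂(χ) = ∏_{n ≥ 0} m_0(χ𝒜^{-n})`. -/
def phiHat {p : ℕ} [NeZero p] (lam : ZMod p → ZMod p → ℂ) (χ : X p) : ℂ :=
  ∏' n : ℕ, mask lam (dilChar (-(n : ℤ)) χ)

/-- The function `φ` with Fourier transform `φ̂`: the inverse Fourier transform of `φ̂`. -/
def phi {p : ℕ} [NeZero p] (lam : ZMod p → ZMod p → ℂ) (x : Vilenkin p) : ℂ :=
  ∫ χ, phiHat lam χ * pairing χ x ∂(nu p)

/-- The coefficients `β_h`, `h ∈ H_0^{(2)}`, of the mask: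
`m_0(χ) = (1/p) ∑_h β_h * conj (χ𝒜⁻¹, h)`. -/
def IsMaskCoeff {p : ℕ} [NeZero p] (lam : ZMod p → ZMod p → ℂ) (β : H0s p 2 → ℂ) : Prop :=
  ∀ χ : X p, mask lam χ =
    1 / (p : ℂ) * ∑ h : H0s p 2, β h * starRingEnd ℂ (pairing (dilChar (-1) χ) h)

/-- `β_h^{(l)} = β_h (r_0^l, 𝒜⁻¹h)`. -/
def waveletCoeff {p : ℕ} [NeZero p] (β : H0s p 2 → ℂ) (l : ℕ) (h : H0s p 2) : ℂ :=
  β h * pairing (rademacher p 0 ^ l) (dil (-1) (h : Vilenkin p))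

/-- The wavelet `ψ_l(x) = ∑_{h ∈ H_0^{(2)}} β_h^{(l)} φ(𝒜x - h)`. -/
def psi {p : ℕ} [NeZero p] (lam : ZMod p → ZMod p → ℂ) (β : H0s p 2 → ℂ) (l : ℕ)
    (x : Vilenkin p) : ℂ :=
  ∑ h : H0s p 2, waveletCoeff β l h * phi lam (dil 1 x - h)

/-- The Hilbert space `L₂(𝔊)`. -/
abbrev L2 (p : ℕ) [NeZero p] : Type := Lp ℂ 2 (mu p)

/-- `V_n`: the closed linear span in `L₂(𝔊)` of the functions `φ(𝒜^n x - h)`, `h ∈ H_0`. -/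
def V {p : ℕ} [NeZero p] (lam : ZMod p → ZMod p → ℂ) (n : ℤ) : Submodule ℂ (L2 p) :=
  (Submodule.span ℂ
    {f : L2 p | ∃ h ∈ H0 p, f =ᵐ[mu p] fun x => phi lam (dil n x - h)}).topologicalClosure

/-- `W_0 = V_1 ⊖ V_0`: the orthogonal complement of `V_0` in `V_1`. -/
def W0 {p : ℕ} [NeZero p] (lam : ZMod p → ZMod p → ℂ) : Submodule ℂ (L2 p) :=
  V lam 1 ⊓ (V lam 0)ᗮ

end VilenkinWavelet

end

/-!
# Wavelets on the Vilenkin group generated by a tree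

A character `χ` of `𝔊` is determined by its digits `digit χ k`, `k ∈ ℤ`, which vanish for large `k`,
and the mask is `m_0(χ) = λ(c_{-1}, c_0)` in terms of the digits `c_k` of `χ` (`mask_eq`). Writing
`par` for the parent map of the tree, extended by `par 0 = 0`, the value `λ(i, j)` has modulus `1`
if `j = par i` and is `0` otherwise (`IsTreeSequence.exists_isParentMap`). Therefore
`φ̂(χ) = ∏ λ(c_{n-1}, c_n)` has modulus `1` if the digits `c_{-1}, c_0, c_1, …` are the path from
`c_{-1}` to the root, and vanishes otherwise: it lives on `p` cosets of `𝔊_{-1}^⊥`, one for each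
value of `c_{-1}` (`IsParentMap.phiHat_eq`). Hence `φ` is an explicit combination of the functions
`1_{𝔊_{-1}} ξ` with `ξ` a path character (`IsParentMap.phi_eq`), and by the formula for the mask
`ψ_l` is such a combination with characters `ξ` whose digits are `b, par b + l` at the places
`-1, 0` and follow the path from `par b + l` to the root afterwards (`IsParentMap.psi_eq`). For
`l = 0` this is `φ` again, which is the refinement equation.

All the functions involved are thus combinations of functions `1_{a + 𝔊_n} ξ`, whose inner products
are known: they vanish as soon as the two characters differ on the smaller of the two cosets.

* Within one scale the functions `ψ_l(𝒜^n x - h)`, `0 ≤ l < p`, arise from an orthogonal system of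
  functions `1_{a + 𝔊_{n-1}} ξ` by a discrete Fourier transform in the digit `b`
  (`IsParentMap.inner_waveVec`, `IsParentMap.cosetVec_mem_span`).
* For `l ≠ 0` the place `n` is the last one where the digits of `ξ` fail to follow the parent map.
  So wavelets of different scales are orthogonal (`IsParentMap.inner_waveVec_of_lt`).
* Subdividing cosets shows that the `ψ_l(x - h)`, `0 ≤ l < p`, together span `V_1`
  (`IsParentMap.inner_waveVec_succ`), which gives the basis of `W_0`.
* For the completeness in `L₂(𝔊)`, let `f` be orthogonal to all wavelets. The same subdivision
  expresses the inner products of `f` with the path functions of level `n` by those of level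
  `n - 1`, with a gain of `1 / p` against a growth of norms by `√p` only. Iterating, they all vanish
  (`IsParentMap.eq_zero_of_inner_waveVec`). The root path gives the indicator functions of all
  cosets, and these are total in `L₂(𝔊)` (`eq_zero_of_inner_cosetVec_one`).
-/

noncomputable section

namespace VilenkinWavelet

section

variable {p : ℕ}

/-! ### Pairing and digits of characters -/

theorem pairing_one (x : Vilenkin p) : pairing 1 x = 1 := by simp [pairing]

theorem pairing_mul (χ ξ : X p) (x : Vilenkin p) :
    pairing (χ * ξ) x = pairing χ x * pairing ξ x := by
  simp only [pairing]
  exact Circle.coe_mul _ _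

theorem pairing_inv (χ : X p) (x : Vilenkin p) :
    pairing χ⁻¹ x = starRingEnd ℂ (pairing χ x) := by
  simp only [pairing]
  exact Circle.coe_inv_eq_conj _

theorem pairing_zero (χ : X p) : pairing χ 0 = 1 := by simp [pairing]

theorem pairing_add (χ : X p) (x y : Vilenkin p) :
    pairing χ (x + y) = pairing χ x * pairing χ y := by simp [pairing]

theorem pairing_neg (χ : X p) (x : Vilenkin p) :
    pairing χ (-x) = starRingEnd ℂ (pairing χ x) := by
  simp only [pairing, ofAdd_neg, map_inv]
  exact Circle.coe_inv_eq_conj _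

theorem pairing_sub (χ : X p) (x y : Vilenkin p) :
    pairing χ (x - y) = pairing χ x * starRingEnd ℂ (pairing χ y) := by
  rw [sub_eq_add_neg, pairing_add, pairing_neg]

theorem norm_pairing (χ : X p) (x : Vilenkin p) : ‖pairing χ x‖ = 1 := Circle.norm_coe _

theorem conj_pairing_mul_self (χ : X p) (x : Vilenkin p) :
    starRingEnd ℂ (pairing χ x) * pairing χ x = 1 := by
  rw [← pairing_inv, ← pairing_mul, inv_mul_cancel, pairing_one]

theorem continuous_pairing (χ : X p) : Continuous (pairing χ) :=
  continuous_subtype_val.comp ((map_continuous χ).comp continuous_ofAdd)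

theorem pairing_ext {χ ξ : X p} (h : ∀ x, pairing χ x = pairing ξ x) : χ = ξ :=
  PontryaginDual.ext fun a => Circle.coe_injective (h a.toAdd)

theorem sub_coord (x y : Vilenkin p) (n : ℤ) : (x - y) n = x n - y n := by
  rw [sub_eq_add_neg, add_coord, neg_coord, sub_eq_add_neg]

theorem sum_coord {ι : Type*} (s : Finset ι) (f : ι → Vilenkin p) (n : ℤ) :
    (∑ i ∈ s, f i : Vilenkin p) n = ∑ i ∈ s, f i n := by
  classical
  induction s using Finset.induction_on with
  | empty => simp [zero_coord]
  | insert a s ha ih => rw [Finset.sum_insert ha, Finset.sum_insert ha, add_coord, ih]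

/-- The sequence `a g_k` with the residue `a` at place `k` and zeros elsewhere. -/
def single (k : ℤ) : ZMod p →+ Vilenkin p where
  toFun a := ⟨Pi.single k a, k, fun n hn => Pi.single_eq_of_ne hn.ne _⟩
  map_zero' := Vilenkin.ext fun n => by
    change (Pi.single k 0 : ℤ → ZMod p) n = 0
    simp
  map_add' a b := Vilenkin.ext fun n => by
    change (Pi.single k (a + b) : ℤ → ZMod p) n
      = (Pi.single k a : ℤ → ZMod p) n + (Pi.single k b : ℤ → ZMod p) n
    rw [Pi.single_add, Pi.add_apply]

theorem single_same (k : ℤ) (a : ZMod p) : single k a k = a := Pi.single_eq_same _ _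

theorem single_of_ne {k n : ℤ} (h : n ≠ k) (a : ZMod p) : single k a n = 0 :=
  Pi.single_eq_of_ne h _

theorem single_mem_chain {k n : ℤ} (h : n ≤ k) (a : ZMod p) : single k a ∈ chain p n :=
  fun m hm => single_of_ne (by omega) a

theorem dil_single (k n : ℤ) (a : ZMod p) : dil k (single n a) = single (n - k) a := by
  refine Vilenkin.ext fun m => ?_
  rw [dil_coord]
  by_cases h : m = n - k
  · subst h; rw [sub_add_cancel, single_same, single_same]
  · rw [single_of_ne h, single_of_ne (by omega)]

theorem dil_dil (k m : ℤ) (x : Vilenkin p) : dil k (dil m x) = dil (k + m) x :=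
  Vilenkin.ext fun n => by
    simp only [dil_coord]
    exact congrArg x.1 (add_assoc n k m)

theorem dil_zero (x : Vilenkin p) : dil 0 x = x :=
  Vilenkin.ext fun n => by rw [dil_coord, add_zero]

theorem dil_mem_chain {k n : ℤ} {x : Vilenkin p} : dil k x ∈ chain p n ↔ x ∈ chain p (n + k) := by
  constructor
  · intro h m hm
    have := h (m - k) (by omega)
    rwa [dil_coord, sub_add_cancel] at this
  · intro h m hm
    exact h _ (by omega)

/-- Characters of `𝔊` have values in the `p`-th roots of unity, since `p x = 0` for all `x`. -/
theorem pairing_pow (χ : X p) (x : Vilenkin p) : pairing χ x ^ p = 1 := by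
  have h : ∀ m : ℕ, pairing χ (m • x) = pairing χ x ^ m := by
    intro m
    induction m with
    | zero => simp [pairing_zero]
    | succ m ih => rw [succ_nsmul, pairing_add, ih, pow_succ]
  have h0 : p • x = 0 := Vilenkin.ext fun n => by
    have h1 : ∀ m : ℕ, (m • x) n = m • x n := by
      intro m
      induction m with
      | zero => simp [zero_coord]
      | succ m ih => rw [succ_nsmul, succ_nsmul, add_coord, ih]
    rw [h1, zero_coord]; simp
  rw [← h, h0, pairing_zero]

theorem isOpen_chain (n : ℤ) : IsOpen (chain p n : Set (Vilenkin p)) :=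
  AddSubgroup.isOpen_of_mem_nhds _ (chain_mem_nhds p n)

/-- Removing the terms at the places `n, …, n + m - 1` from an element of `𝔊_n`. -/
theorem sub_sum_single_mem_chain {n : ℤ} {x : Vilenkin p} (hx : x ∈ chain p n) (m : ℕ) :
    x - ∑ k ∈ Finset.range m, single (n + k) (x (n + k)) ∈ chain p (n + m) := by
  intro j hj
  rw [sub_coord, sum_coord]
  by_cases h : j < n
  · rw [hx j h, Finset.sum_eq_zero, sub_zero]
    intro k _
    exact single_of_ne (by omega) _
  · rw [Finset.sum_eq_single (j - n).toNat]
    · have : n + ((j - n).toNat : ℤ) = j := by omega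
      rw [this, single_same, sub_self]
    · intro k _ hk
      exact single_of_ne (by omega) _
    · intro h'
      exact absurd (Finset.mem_range.2 (by omega)) h'

variable [NeZero p]

theorem sum_stdAddChar (b : ZMod p) :
    ∑ a : ZMod p, ZMod.stdAddChar (a * b) = if b = 0 then (p : ℂ) else 0 := by
  classical
  have := AddChar.sum_mulShift b (ZMod.isPrimitive_stdAddChar p)
  rw [ZMod.card] at this
  split_ifs at this ⊢ <;> simpa using this

theorem conj_stdAddChar (a : ZMod p) :
    starRingEnd ℂ (ZMod.stdAddChar a) = ZMod.stdAddChar (-a) := by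
  rw [ZMod.stdAddChar_apply, ZMod.stdAddChar_apply, AddChar.map_neg_eq_inv,
    Circle.coe_inv_eq_conj]

theorem exists_digit (χ : X p) (k : ℤ) :
    ∃ c : ZMod p, ∀ a, pairing χ (single k a) = ZMod.stdAddChar (c * a) := by
  have hpow : (pairing χ (single k 1)) ^ p = 1 := by
    have h : ∀ m : ℕ, pairing χ (single k (m : ZMod p)) = pairing χ (single k 1) ^ m := by
      intro m
      induction m with
      | zero => simp [pairing_zero]
      | succ m ih => rw [Nat.cast_succ, map_add, pairing_add, ih, pow_succ]
    rw [← h, ZMod.natCast_self, map_zero, pairing_zero]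
  obtain ⟨i, -, hi⟩ := (Complex.isPrimitiveRoot_exp p (NeZero.ne p)).eq_pow_of_pow_eq_one hpow
  have h1 : pairing χ (single k 1) = ZMod.stdAddChar (i : ZMod p) := by
    have := ZMod.stdAddChar_coe (N := p) i
    rw [Int.cast_natCast] at this
    rw [this, ← hi, ← Complex.exp_nat_mul]
    congr 1
    push_cast
    ring
  refine ⟨i, fun a => ?_⟩
  have h2 : ∀ m : ℕ, pairing χ (single k (m : ZMod p)) =
      ZMod.stdAddChar ((i : ZMod p) * (m : ZMod p)) := by
    intro m
    induction m with
    | zero => simp [pairing_zero]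
    | succ m ih =>
      rw [Nat.cast_succ, map_add, pairing_add, ih, h1, ← AddChar.map_add_eq_mul, mul_add, mul_one]
  simpa using h2 a.val

/-- The `k`-th digit of a character: the residue `c` with `(χ, a g_k) = exp(2πi c a / p)` for all
residues `a`. A character is determined by its digits, and equals `∏ r_k ^ (digit χ k)`. -/
def digit (χ : X p) (k : ℤ) : ZMod p := (exists_digit χ k).choose

theorem pairing_single (χ : X p) (k : ℤ) (a : ZMod p) :
    pairing χ (single k a) = ZMod.stdAddChar (digit χ k * a) := (exists_digit χ k).choose_spec a

theorem digit_eq {χ : X p} {k : ℤ} {c : ZMod p}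
    (h : pairing χ (single k 1) = ZMod.stdAddChar c) : digit χ k = c := by
  rw [pairing_single, mul_one] at h
  exact ZMod.injective_stdAddChar h

theorem digit_one (k : ℤ) : digit (1 : X p) k = 0 :=
  digit_eq (by rw [pairing_one, AddChar.map_zero_eq_one])

theorem digit_mul (χ ξ : X p) (k : ℤ) : digit (χ * ξ) k = digit χ k + digit ξ k :=
  digit_eq (by
    rw [pairing_mul, pairing_single, pairing_single, mul_one, mul_one, AddChar.map_add_eq_mul])

theorem digit_inv (χ : X p) (k : ℤ) : digit χ⁻¹ k = -digit χ k := by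
  have := digit_mul χ⁻¹ χ k
  rw [inv_mul_cancel, digit_one] at this
  exact eq_neg_of_add_eq_zero_left this.symm

theorem digit_pow (χ : X p) (m : ℕ) (k : ℤ) : digit (χ ^ m) k = m * digit χ k := by
  induction m with
  | zero => simp [digit_one]
  | succ m ih => rw [pow_succ, digit_mul, ih]; push_cast; ring

theorem digit_prod {ι : Type*} (s : Finset ι) (f : ι → X p) (k : ℤ) :
    digit (∏ i ∈ s, f i) k = ∑ i ∈ s, digit (f i) k := by
  classical
  induction s using Finset.induction_on with
  | empty => simp [digit_one]
  | insert a s ha ih => rw [Finset.prod_insert ha, Finset.sum_insert ha, digit_mul, ih]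

theorem pairing_rademacher_eq (n : ℤ) (x : Vilenkin p) :
    pairing (rademacher p n) x = ZMod.stdAddChar (x n) := rfl

theorem digit_rademacher (n k : ℤ) : digit (rademacher p n) k = if k = n then 1 else 0 := by
  refine digit_eq ?_
  rw [pairing_rademacher_eq]
  split_ifs with h
  · rw [h, single_same]
  · rw [single_of_ne (Ne.symm h)]

theorem digit_dilChar (m : ℤ) (χ : X p) (k : ℤ) : digit (dilChar m χ) k = digit χ (k - m) :=
  digit_eq (by rw [pairing_dilChar, dil_single, pairing_single, mul_one])

/-- The complement of the nontrivial `p`-th roots of unity is open. A character with values in it on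
a subgroup is trivial there. -/
theorem isOpen_compl_roots :
    IsOpen {z : Circle | (z : ℂ) ^ p = 1 → z = 1} := by
  have hfin : {z : Circle | (z : ℂ) ^ p = 1 ∧ z ≠ 1}.Finite := by
    have h1 : {z : ℂ | z ^ p = 1}.Finite := by
      have := (Polynomial.nthRootsFinset p (1 : ℂ)).finite_toSet
      refine this.subset fun z hz => ?_
      exact (Polynomial.mem_nthRootsFinset (NeZero.pos p) 1).2 hz
    exact (h1.preimage Circle.coe_injective.injOn).subset fun z hz => hz.1
  convert hfin.isClosed.isOpen_compl using 1
  ext z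
  simp only [Set.mem_ofPred_eq, Set.mem_compl_iff]
  tauto

/-- By continuity a character is trivial on some `𝔊_N`. -/
theorem exists_mem_annihilator (χ : X p) : ∃ N : ℕ, χ ∈ annihilator p N := by
  have hc : Continuous fun x : Vilenkin p => χ (Multiplicative.ofAdd x) :=
    (map_continuous χ).comp continuous_ofAdd
  have hU : (fun x : Vilenkin p => χ (Multiplicative.ofAdd x)) ⁻¹'
      {z : Circle | (z : ℂ) ^ p = 1 → z = 1} ∈ nhds 0 := by
    refine (isOpen_compl_roots.preimage hc).mem_nhds ?_
    simp
  obtain ⟨n, -, hn⟩ := (nhds_hasBasis (0 : Vilenkin p)).mem_iff.1 hU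
  refine ⟨n.toNat, fun x hx => ?_⟩
  have h1 : x - 0 ∈ chain p n := by
    rw [sub_zero]; exact chain_anti p (Int.self_le_toNat n) hx
  have := hn h1 (pairing_pow χ x)
  simp only [pairing, this, Circle.coe_one]

/-- The subgroup `𝔊_n` is topologically generated by the `g_k`, `k ≥ n`, so a character is trivial
on it if its digits from place `n` on vanish. -/
theorem mem_annihilator_iff {n : ℤ} {χ : X p} :
    χ ∈ annihilator p n ↔ ∀ k, n ≤ k → digit χ k = 0 := by
  constructor
  · intro h k hk
    refine digit_eq ?_
    rw [h _ (single_mem_chain hk 1), AddChar.map_zero_eq_one]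
  · intro h x hx
    obtain ⟨N, hN⟩ := exists_mem_annihilator χ
    have h1 := hN _ (chain_anti p (show (N : ℤ) ≤ n + ((N - n).toNat : ℕ) by omega)
      (sub_sum_single_mem_chain hx (N - n).toNat))
    have h2 : pairing χ (∑ k ∈ Finset.range (N - n).toNat, single (n + k) (x (n + k))) = 1 := by
      refine Finset.sum_induction _ (fun y => pairing χ y = 1) ?_ (pairing_zero χ) ?_
      · intro a b ha hb; rw [pairing_add, ha, hb, one_mul]
      · intro k _
        rw [pairing_single, h _ (by omega), zero_mul, AddChar.map_zero_eq_one]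
    rw [pairing_sub, h2, map_one, mul_one] at h1
    exact h1

theorem digit_ext {χ ξ : X p} (h : ∀ k, digit χ k = digit ξ k) : χ = ξ := by
  refine pairing_ext fun x => ?_
  obtain ⟨m, hm⟩ := x.2
  have h1 : χ * ξ⁻¹ ∈ annihilator p m := mem_annihilator_iff.2 fun k _ => by
    rw [digit_mul, digit_inv, h, add_neg_cancel]
  have h2 := h1 x hm
  rw [pairing_mul, pairing_inv] at h2
  calc pairing χ x = pairing χ x * (starRingEnd ℂ (pairing ξ x) * pairing ξ x) := by
        rw [conj_pairing_mul_self, mul_one]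
    _ = pairing ξ x := by rw [← mul_assoc, h2, one_mul]

theorem exists_digit_eq_zero (χ : X p) : ∃ N : ℕ, ∀ k : ℤ, N ≤ k → digit χ k = 0 := by
  obtain ⟨N, hN⟩ := exists_mem_annihilator χ
  exact ⟨N, mem_annihilator_iff.1 hN⟩

/-! ### The mask in terms of digits -/

theorem mem_periodicCoset_iff {i j : ZMod p} {χ : X p} :
    χ ∈ periodicCoset p i j ↔ digit χ (-1) = i ∧ digit χ 0 = j := by
  have key : ∀ (s : ℕ) (α : ℕ → ℕ) (k : ℤ),
      digit (rademacher p (-1) ^ i.val * rademacher p 0 ^ j.val *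
        ∏ k ∈ Finset.Icc 1 s, rademacher p k ^ α k) k
      = (if k = -1 then i else 0) + (if k = 0 then j else 0) +
        ∑ m ∈ Finset.Icc 1 s, if k = m then (α m : ZMod p) else 0 := by
    intro s α k
    simp only [digit_mul, digit_pow, digit_prod, digit_rademacher, mul_ite, mul_one, mul_zero,
      ZMod.natCast_val, ZMod.cast_id', id]
  constructor
  · rintro ⟨ζ, hζ, s, α, rfl⟩
    rw [mem_annihilator_iff] at hζ
    have hs : ∀ k : ℤ, k ≤ 0 →
        ∑ m ∈ Finset.Icc 1 s, (if k = m then (α m : ZMod p) else 0) = 0 := fun k hk =>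
      Finset.sum_eq_zero fun m hm => if_neg (by have := (Finset.mem_Icc.1 hm).1; omega)
    have e : ζ * rademacher p (-1) ^ i.val * rademacher p 0 ^ j.val *
        ∏ k ∈ Finset.Icc 1 s, rademacher p k ^ α k = ζ * (rademacher p (-1) ^ i.val *
        rademacher p 0 ^ j.val * ∏ k ∈ Finset.Icc 1 s, rademacher p k ^ α k) := by
      simp only [mul_assoc]
    rw [e, digit_mul ζ, digit_mul ζ, key, key, hs _ (by norm_num), hs _ le_rfl, hζ _ le_rfl,
      hζ 0 (by norm_num)]
    simp
  · rintro ⟨hi, hj⟩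
    obtain ⟨N, hN⟩ := exists_digit_eq_zero χ
    set R : X p := rademacher p (-1) ^ i.val * rademacher p 0 ^ j.val *
        ∏ k ∈ Finset.Icc 1 N, rademacher p k ^ (digit χ k).val with hR
    refine ⟨χ * R⁻¹, ?_, N, fun k => (digit χ k).val, ?_⟩
    · rw [mem_annihilator_iff]
      intro k hk
      rw [digit_mul, digit_inv, hR, key N (fun k => (digit χ k).val)]
      rcases lt_trichotomy k 0 with h | h | h
      · obtain rfl : k = -1 := by omega
        rw [Finset.sum_eq_zero, hi]
        · simp
        · intro m hm; exact if_neg (by omega)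
      · subst h
        rw [Finset.sum_eq_zero, hj]
        · simp
        · intro m hm; exact if_neg (by have := (Finset.mem_Icc.1 hm).1; omega)
      · rw [if_neg (by omega), if_neg (by omega), Finset.sum_eq_single k.toNat]
        · have : ((k.toNat : ℕ) : ℤ) = k := by omega
          rw [this]; simp
        · intro m _ hm; exact if_neg (by omega)
        · intro h'
          have hk' : (N : ℤ) ≤ k := by
            by_contra hlt
            exact h' (Finset.mem_Icc.2 (by omega))
          have : ((k.toNat : ℕ) : ℤ) = k := by omega
          rw [this, hN k hk']; simp
    · have : χ * R⁻¹ * rademacher p (-1) ^ i.val * rademacher p 0 ^ j.val *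
          ∏ k ∈ Finset.Icc 1 N, rademacher p k ^ (digit χ k).val = χ * R⁻¹ * R := by
        rw [hR]; simp only [mul_assoc]
      rw [this, inv_mul_cancel_right]

theorem mask_eq (lam : ZMod p → ZMod p → ℂ) (χ : X p) :
    mask lam χ = lam (digit χ (-1)) (digit χ 0) := by
  simp only [mask, mem_periodicCoset_iff]
  rw [Finset.sum_eq_single (digit χ (-1)), Finset.sum_eq_single (digit χ 0)]
  · simp
  · intro b _ hb; simp [hb.symm]
  · simp
  · intro b _ hb; simp [hb.symm]
  · simp

end

section

variable {p : ℕ}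

/-! ### The parent map of a rooted tree -/

/-- A nonroot vertex has exactly one parent. -/
theorem existsUnique_isTreeEdge {T : SimpleGraph (ZMod p)} (hT : T.IsTree) {i : ZMod p}
    (hi : i ≠ 0) : ∃! j, IsTreeEdge T j i := by
  obtain ⟨q, hq, hql⟩ := hT.connected.exists_path_of_dist 0 i
  have hnil : ¬ q.Nil := fun h => hi h.eq.symm
  refine ⟨q.penultimate, ⟨q.adj_penultimate hnil, ?_⟩, ?_⟩
  · have h1 : T.dist 0 q.penultimate ≤ q.dropLast.length := SimpleGraph.dist_le _
    have h2 : q.dropLast.length + 1 = q.length := by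
      simp only [SimpleGraph.Walk.length_dropLast]
      have := SimpleGraph.Walk.not_nil_iff_lt_length.1 hnil
      omega
    have h3 := hT.dist_eq_dist_add_one_of_adj 0 (q.adj_penultimate hnil)
    omega
  -- a shortest path to another parent `j` extends to a path to `i`, and paths are unique
  · rintro j ⟨hadj, hd⟩
    obtain ⟨r, hr, hrl⟩ := hT.connected.exists_path_of_dist 0 j
    have hir : i ∉ r.support := fun h => by
      have h1 : T.dist 0 i ≤ (r.takeUntil i h).length := SimpleGraph.dist_le _
      have h2 := r.length_takeUntil_le_length h
      omega
    rw [(hT.existsUnique_path 0 i).unique hq (hr.concat hir hadj),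
      SimpleGraph.Walk.penultimate_concat]

/-- The data extracted from a tree sequence `lam`. The map `par` sends a vertex of the tree to its
parent and fixes the root, and `N` bounds the height of the tree. Including the pair `(0, 0)`, the
values of `lam` are supported on the pairs `(i, par i)`. -/
structure IsParentMap (par : ZMod p → ZMod p) (N : ℕ) (lam : ZMod p → ZMod p → ℂ) : Prop where
  iterate_eq_zero : ∀ i, par^[N] i = 0
  par_zero : par 0 = 0
  lam_zero : lam 0 0 = 1
  norm_lam : ∀ i, ‖lam i (par i)‖ = 1
  lam_eq_zero : ∀ i j, j ≠ par i → lam i j = 0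

theorem IsTreeSequence.exists_isParentMap [NeZero p] {T : SimpleGraph (ZMod p)} (hT : T.IsTree)
    {lam : ZMod p → ZMod p → ℂ} (h : IsTreeSequence T lam) :
    ∃ par N, IsParentMap par N lam := by
  classical
  let par : ZMod p → ZMod p := fun i =>
    if hi : i = 0 then 0 else (existsUnique_isTreeEdge hT hi).choose
  have par0 : par 0 = 0 := dif_pos rfl
  have parE : ∀ i, i ≠ 0 → IsTreeEdge T (par i) i := fun i hi => by
    simp only [par, dif_neg hi]
    exact (existsUnique_isTreeEdge hT hi).choose_spec.1
  have parU : ∀ i j, IsTreeEdge T j i → j = par i := fun i j hj => by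
    have hi : i ≠ 0 := by
      rintro rfl
      have := hj.2
      simp at this
    exact (existsUnique_isTreeEdge hT hi).unique hj (parE i hi)
  have hdist : ∀ m : ℕ, ∀ i, T.dist 0 i ≤ m → par^[m] i = 0 := by
    intro m
    induction m with
    | zero =>
      intro i hi
      exact ((hT.connected.dist_eq_zero_iff).1 (Nat.le_zero.1 hi)).symm
    | succ m ih =>
      intro i hi
      rw [Function.iterate_succ_apply]
      refine ih _ ?_
      by_cases h0 : i = 0
      · subst h0; simp [par0]
      · have := (parE i h0).2; omega
  refine ⟨par, ∑ i, T.dist 0 i, fun i => hdist _ i ?_, par0, h.zero, fun i => ?_, fun i j hj => ?_⟩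
  · exact Finset.single_le_sum (f := fun i => T.dist 0 i) (fun _ _ => Nat.zero_le _)
      (Finset.mem_univ i)
  · by_cases h0 : i = 0
    · subst h0; rw [par0, h.zero, norm_one]
    · exact h.edge i _ (parE i h0)
  · refine h.other i j (fun he => hj (parU i j he)) ?_
    rintro ⟨⟩
    exact hj par0.symm

variable {par : ZMod p → ZMod p} {N : ℕ} {lam : ZMod p → ZMod p → ℂ}

theorem IsParentMap.iterate_of_le (H : IsParentMap par N lam) {k : ℕ} (hk : N ≤ k) (j : ZMod p) :
    par^[k] j = 0 := by
  obtain ⟨m, rfl⟩ := Nat.exists_eq_add_of_le hk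
  rw [Function.iterate_add_apply, H.iterate_eq_zero]

/-- The product of the values `λ` along the path from `b` to the root. -/
def pathWeight (par : ZMod p → ZMod p) (N : ℕ) (lam : ZMod p → ZMod p → ℂ) (b : ZMod p) : ℂ :=
  ∏ k ∈ Finset.range N, lam (par^[k] b) (par^[k + 1] b)

theorem IsParentMap.norm_pathWeight (H : IsParentMap par N lam) (b : ZMod p) :
    ‖pathWeight par N lam b‖ = 1 := by
  rw [pathWeight, norm_prod]
  exact Finset.prod_eq_one fun k _ => by rw [Function.iterate_succ_apply', H.norm_lam]

theorem IsParentMap.pathWeight_eq (H : IsParentMap par N lam) (b : ZMod p) :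
    pathWeight par N lam b = lam b (par b) * pathWeight par N lam (par b) := by
  have h1 : ∏ k ∈ Finset.range (N + 1), lam (par^[k] b) (par^[k + 1] b)
      = pathWeight par N lam b := by
    rw [Finset.prod_range_succ, H.iterate_eq_zero, H.iterate_of_le (Nat.le_succ N), H.lam_zero,
      mul_one, pathWeight]
  rw [← h1, Finset.prod_range_succ', mul_comm]
  rfl

variable [NeZero p]

/-! ### Characters along paths to the root -/

/-- The character `∏_{k < N} r_{n+k}^{par^k j}`. If `par^N = 0` its digits vanish below `n`, and
from place `n` on they are `j, par j, par² j, …`, the path from `j` to the root. -/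
def pathChar (par : ZMod p → ZMod p) (N : ℕ) (n : ℤ) (j : ZMod p) : X p :=
  ∏ k ∈ Finset.range N, rademacher p (n + k) ^ (par^[k] j).val

/-- The character `r_{n-1}^b` times the path character from `j` at place `n`. -/
def branchChar (par : ZMod p → ZMod p) (N : ℕ) (n : ℤ) (b j : ZMod p) : X p :=
  rademacher p (n - 1) ^ b.val * pathChar par N n j


theorem digit_pathChar_of_lt {n k : ℤ} (h : k < n) (j : ZMod p) :
    digit (pathChar par N n j) k = 0 := by
  rw [pathChar, digit_prod]
  refine Finset.sum_eq_zero fun m _ => ?_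
  rw [digit_pow, digit_rademacher, if_neg (by omega), mul_zero]

theorem IsParentMap.digit_pathChar (H : IsParentMap par N lam) (n : ℤ) (k : ℕ) (j : ZMod p) :
    digit (pathChar par N n j) (n + k) = par^[k] j := by
  rw [pathChar, digit_prod]
  by_cases hk : k < N
  · rw [Finset.sum_eq_single k]
    · rw [digit_pow, digit_rademacher, if_pos rfl, mul_one]; simp
    · intro m _ hm
      rw [digit_pow, digit_rademacher, if_neg (by omega), mul_zero]
    · intro h; exact absurd (Finset.mem_range.2 hk) h
  · rw [H.iterate_of_le (by omega)]
    refine Finset.sum_eq_zero fun m hm => ?_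
    have := Finset.mem_range.1 hm
    rw [digit_pow, digit_rademacher, if_neg (by omega), mul_zero]

theorem digit_branchChar_pred (n : ℤ) (b j : ZMod p) :
    digit (branchChar par N n b j) (n - 1) = b := by
  rw [branchChar, digit_mul, digit_pathChar_of_lt (by omega), digit_pow, digit_rademacher,
    if_pos rfl]
  simp

theorem IsParentMap.digit_branchChar (H : IsParentMap par N lam) (n : ℤ) (k : ℕ) (b j : ZMod p) :
    digit (branchChar par N n b j) (n + k) = par^[k] j := by
  rw [branchChar, digit_mul, H.digit_pathChar, digit_pow, digit_rademacher,
    if_neg (by omega), mul_zero, zero_add]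

theorem digit_branchChar_of_lt {n k : ℤ} (h : k < n - 1) (b j : ZMod p) :
    digit (branchChar par N n b j) k = 0 := by
  rw [branchChar, digit_mul, digit_pathChar_of_lt (by omega), digit_pow, digit_rademacher,
    if_neg (by omega), mul_zero, zero_add]

/-- The path character from `b` at place `n - 1` is a branch character at place `n`. -/
theorem IsParentMap.branchChar_par (H : IsParentMap par N lam) (n : ℤ) (b : ZMod p) :
    branchChar par N n b (par b) = pathChar par N (n - 1) b := by
  refine digit_ext fun k => ?_
  rcases lt_trichotomy k (n - 1) with h | h | h
  · rw [digit_branchChar_of_lt h, digit_pathChar_of_lt h]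
  · subst h
    have := H.digit_pathChar (n - 1) 0 b
    rw [digit_branchChar_pred]
    simpa using this.symm
  · obtain ⟨m, rfl⟩ : ∃ m : ℕ, k = n + m := ⟨(k - n).toNat, by omega⟩
    have := H.digit_pathChar (n - 1) (m + 1) b
    rw [H.digit_branchChar, ← Function.iterate_succ_apply, ← this]
    congr 1; push_cast; ring

theorem dilChar_pathChar (m n : ℤ) (j : ZMod p) :
    dilChar m (pathChar par N n j) = pathChar par N (n + m) j := by
  refine digit_ext fun k => ?_
  rw [digit_dilChar, pathChar, pathChar, digit_prod, digit_prod]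
  refine Finset.sum_congr rfl fun i _ => ?_
  rw [digit_pow, digit_pow, digit_rademacher, digit_rademacher]
  congr 2
  exact propext ⟨fun h => by omega, fun h => by omega⟩

theorem dilChar_branchChar (m n : ℤ) (b j : ZMod p) :
    dilChar m (branchChar par N n b j) = branchChar par N (n + m) b j := by
  refine digit_ext fun k => ?_
  rw [branchChar, branchChar, digit_mul, ← dilChar_pathChar m n, digit_dilChar, digit_dilChar,
    digit_mul, digit_pow, digit_pow, digit_rademacher, digit_rademacher]
  congr 3
  exact propext ⟨fun h => by omega, fun h => by omega⟩

theorem IsParentMap.pathChar_zero (H : IsParentMap par N lam) (n : ℤ) :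
    pathChar par N n 0 = 1 := by
  have h0 : ∀ k : ℕ, par^[k] 0 = 0 := fun k => Function.iterate_fixed H.par_zero k
  rw [pathChar]
  exact Finset.prod_eq_one fun k _ => by rw [h0]; simp

/-! ### The Fourier transform of the refinable function -/

/-- Almost all factors of the infinite product are `λ_0 = 1`. -/
theorem phiHat_eq_prod (lam : ZMod p → ZMod p → ℂ) (h0 : lam 0 0 = 1) (χ : X p) (M : ℕ)
    (hM : ∀ k : ℤ, (M : ℤ) - 1 ≤ k → digit χ k = 0) :
    phiHat lam χ = ∏ n ∈ Finset.range M, lam (digit χ (n - 1)) (digit χ n) := by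
  have h : ∀ n : ℕ, mask lam (dilChar (-(n : ℤ)) χ) = lam (digit χ (n - 1)) (digit χ n) := by
    intro n
    rw [mask_eq, digit_dilChar, digit_dilChar]
    congr 2
    · omega
    · omega
  rw [phiHat, tprod_eq_prod (s := Finset.range M)]
  · exact Finset.prod_congr rfl fun n _ => h n
  · intro n hn
    rw [Finset.mem_range, not_lt] at hn
    rw [h, hM _ (by omega), hM _ (by omega), h0]

/-- `φ̂` is a step function: it has constant modulus `1` on the `p` cosets of `𝔊_{-1}^⊥` whose
digits from place `-1` on form a path to the root, and vanishes elsewhere. -/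
theorem IsParentMap.phiHat_eq (H : IsParentMap par N lam) (χ : X p) :
    phiHat lam χ = ∑ b, (annihilator p (-1) : Set (X p)).indicator
      (fun _ => pathWeight par N lam b) ((pathChar par N (-1) b)⁻¹ * χ) := by
  obtain ⟨M, hM⟩ := exists_digit_eq_zero χ
  have hprod := phiHat_eq_prod lam H.lam_zero χ (M + N + 1) (fun k hk => hM k (by omega))
  have hmem : ∀ b, (pathChar par N (-1) b)⁻¹ * χ ∈ annihilator p (-1) ↔
      ∀ k : ℕ, digit χ (-1 + k) = par^[k] b := by
    intro b
    rw [mem_annihilator_iff]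
    constructor
    · intro h k
      have := h (-1 + k) (by omega)
      rw [digit_mul, digit_inv, H.digit_pathChar] at this
      exact (neg_add_eq_zero.1 this).symm
    · intro h k hk
      obtain ⟨m, rfl⟩ : ∃ m : ℕ, k = -1 + m := ⟨(k + 1).toNat, by omega⟩
      rw [digit_mul, digit_inv, H.digit_pathChar, h, neg_add_cancel]
  have hne : ∀ b, b ≠ digit χ (-1) →
      ¬ (pathChar par N (-1) b)⁻¹ * χ ∈ annihilator p (-1) := by
    intro b hb h
    have := (hmem b).1 h 0
    simp only [Nat.cast_zero, add_zero, Function.iterate_zero, id] at this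
    exact hb this.symm
  rw [Finset.sum_eq_single (digit χ (-1))
    (fun b _ hb => Set.indicator_of_notMem (hne b hb) _) (by simp)]
  by_cases hp : ∀ k : ℕ, digit χ (-1 + k) = par^[k] (digit χ (-1))
  · rw [Set.indicator_of_mem ((hmem _).2 hp), hprod]
    have e : ∀ n : ℕ, lam (digit χ (n - 1)) (digit χ n) =
        lam (par^[n] (digit χ (-1))) (par^[n + 1] (digit χ (-1))) := by
      intro n
      rw [← hp, ← hp]
      congr 2
      all_goals push_cast
      all_goals omega
    rw [Finset.prod_congr rfl fun n _ => e n, add_right_comm, add_comm _ N, pathWeight,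
      Finset.prod_range_add, mul_eq_left₀]
    · refine Finset.prod_eq_one fun k _ => ?_
      rw [H.iterate_of_le (by omega), H.iterate_of_le (by omega), H.lam_zero]
    · rw [← norm_ne_zero_iff]
      have := H.norm_pathWeight (digit χ (-1))
      rw [pathWeight] at this
      rw [this]; exact one_ne_zero
  · rw [Set.indicator_of_notMem (fun h => hp ((hmem _).1 h)), hprod]
    -- some factor vanishes, at the first place where the digits leave the path
    by_contra hz
    have hz' : ∀ n : ℕ, n < M + N + 1 → digit χ n = par (digit χ (n - 1)) := by
      intro n hn
      by_contra h
      exact hz (Finset.prod_eq_zero (Finset.mem_range.2 hn) (H.lam_eq_zero _ _ h))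
    have hlt : ∀ k : ℕ, k ≤ M + N + 1 → digit χ (-1 + k) = par^[k] (digit χ (-1)) := by
      intro k
      induction k with
      | zero => intro _; simp
      | succ k ih =>
        intro hk
        have h1 := hz' k (by omega)
        rw [Function.iterate_succ_apply', ← ih (by omega)]
        have e1 : (-1 + ((k + 1 : ℕ) : ℤ)) = k := by push_cast; ring
        have e2 : (-1 + (k : ℤ)) = k - 1 := by ring
        rw [e1, e2, h1]
    refine hp fun k => ?_
    by_cases hk : k ≤ M + N + 1
    · exact hlt k hk
    · rw [H.iterate_of_le (by omega), hM _ (by omega)]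

/-! ### The coefficients of the mask -/

/-- An element of `H_0^{(2)}` is given by its two residues at `-1` and `-2`. -/
def H0sTwoEquiv : H0s p 2 ≃ ZMod p × ZMod p where
  toFun h := ((h : Vilenkin p) (-1), (h : Vilenkin p) (-2))
  invFun a := ⟨single (-1) a.1 + single (-2) a.2, fun n hn => by
    rw [add_coord, single_of_ne (by push_cast at hn; omega),
      single_of_ne (by push_cast at hn; omega), add_zero]⟩
  left_inv h := Subtype.ext <| Vilenkin.ext fun n => by
    rw [add_coord]
    by_cases h1 : n = -1
    · subst h1; rw [single_same, single_of_ne (by omega), add_zero]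
    by_cases h2 : n = -2
    · subst h2; rw [single_same, single_of_ne (by omega), zero_add]
    rw [single_of_ne h1, single_of_ne h2, add_zero, h.2 n (by push_cast; omega)]
  right_inv a := by
    refine Prod.ext ?_ ?_
    · change (single (-1) a.1 + single (-2) a.2 : Vilenkin p) (-1) = a.1
      rw [add_coord, single_same, single_of_ne (by omega), add_zero]
    · change (single (-1) a.1 + single (-2) a.2 : Vilenkin p) (-2) = a.2
      rw [add_coord, single_same, single_of_ne (by omega), zero_add]

theorem pairing_H0s_two (χ : X p) (h : H0s p 2) :
    pairing χ (dil (-1) (h : Vilenkin p)) = ZMod.stdAddChar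
      (digit χ 0 * (H0sTwoEquiv h).1 + digit χ (-1) * (H0sTwoEquiv h).2) := by
  have e : (h : Vilenkin p) = single (-1) (H0sTwoEquiv h).1 + single (-2) (H0sTwoEquiv h).2 :=
    (congrArg Subtype.val (H0sTwoEquiv.symm_apply_apply h)).symm
  rw [e, map_add, dil_single, dil_single, pairing_add, pairing_single, pairing_single,
    AddChar.map_add_eq_mul]
  norm_num

theorem sum_stdAddChar_two (c d : ZMod p) :
    ∑ a : ZMod p × ZMod p, ZMod.stdAddChar (a.1 * c + a.2 * d)
      = if c = 0 ∧ d = 0 then (p : ℂ) ^ 2 else 0 := by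
  simp only [AddChar.map_add_eq_mul]
  rw [Fintype.sum_prod_type]
  simp only [← Finset.mul_sum, ← Finset.sum_mul, sum_stdAddChar]
  by_cases h1 : c = 0 <;> by_cases h2 : d = 0 <;> simp [h1, h2, sq]

theorem isMaskCoeff_iff {lam : ZMod p → ZMod p → ℂ} {β : H0s p 2 → ℂ} :
    IsMaskCoeff lam β ↔ ∀ i j, lam i j = 1 / (p : ℂ) * ∑ a : ZMod p × ZMod p,
      β (H0sTwoEquiv.symm a) * ZMod.stdAddChar (-(j * a.1 + i * a.2)) := by
  have key : ∀ χ : X p, ∑ h : H0s p 2, β h * starRingEnd ℂ (pairing (dilChar (-1) χ) h)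
      = ∑ a : ZMod p × ZMod p, β (H0sTwoEquiv.symm a) *
          ZMod.stdAddChar (-(digit χ 0 * a.1 + digit χ (-1) * a.2)) := by
    intro χ
    rw [← H0sTwoEquiv.symm.sum_comp]
    refine Finset.sum_congr rfl fun a _ => ?_
    rw [pairing_dilChar, pairing_H0s_two, conj_stdAddChar, Equiv.apply_symm_apply]
  constructor
  · intro h i j
    have := h (rademacher p (-1) ^ i.val * rademacher p 0 ^ j.val)
    rw [key, mask_eq] at this
    simpa [digit_mul, digit_pow, digit_rademacher] using this
  · intro h χ
    rw [key, mask_eq]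
    exact h _ _

/-- The coefficients of the mask are its Fourier coefficients as a function of two digits. -/
theorem existsUnique_isMaskCoeff (lam : ZMod p → ZMod p → ℂ) :
    ∃! β : H0s p 2 → ℂ, IsMaskCoeff lam β := by
  have hp : (p : ℂ) ≠ 0 := Nat.cast_ne_zero.2 (NeZero.ne p)
  have hsum : ∀ (f : ZMod p × ZMod p → ℂ) (c : ZMod p × ZMod p),
      ∑ a : ZMod p × ZMod p, ∑ b : ZMod p × ZMod p,
        f b * ZMod.stdAddChar (a.1 * (b.1 - c.1) + a.2 * (b.2 - c.2)) = f c * (p : ℂ) ^ 2 := by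
    intro f c
    rw [Finset.sum_comm, Finset.sum_eq_single c]
    · rw [← Finset.mul_sum, sum_stdAddChar_two, if_pos (by simp)]
    · intro b _ hb
      rw [← Finset.mul_sum, sum_stdAddChar_two, if_neg, mul_zero]
      rintro ⟨h1, h2⟩
      exact hb (Prod.ext (sub_eq_zero.1 h1) (sub_eq_zero.1 h2))
    · simp
  refine ⟨fun h => 1 / (p : ℂ) * ∑ b : ZMod p × ZMod p, lam b.2 b.1 *
    ZMod.stdAddChar (b.1 * (H0sTwoEquiv h).1 + b.2 * (H0sTwoEquiv h).2), ?_, ?_⟩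
  · refine isMaskCoeff_iff.2 ?_
    intro i j
    simp only [Equiv.apply_symm_apply]
    have := hsum (fun b => lam b.2 b.1) (j, i)
    calc lam i j = 1 / (p : ℂ) * (1 / (p : ℂ)) * (lam i j * (p : ℂ) ^ 2) := by field_simp
      _ = _ := by
        rw [← this, Finset.mul_sum, Finset.mul_sum]
        refine Finset.sum_congr rfl fun a _ => ?_
        rw [mul_assoc, mul_assoc, Finset.sum_mul]
        congr 2
        refine Finset.sum_congr rfl fun b _ => ?_
        rw [mul_assoc, ← AddChar.map_add_eq_mul]
        congr 2
        ring
  · intro β hβ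
    rw [isMaskCoeff_iff] at hβ
    funext h
    have := hsum (fun b => β (H0sTwoEquiv.symm b)) (H0sTwoEquiv h)
    rw [Equiv.symm_apply_apply] at this
    calc β h = 1 / (p : ℂ) * (1 / (p : ℂ)) * (β h * (p : ℂ) ^ 2) := by field_simp
      _ = _ := by
        rw [← this, mul_assoc, Finset.mul_sum]
        congr 1
        refine (Equiv.sum_comp (Equiv.neg (ZMod p × ZMod p)) _).symm.trans ?_
        refine Finset.sum_congr rfl fun b _ => ?_
        rw [hβ, mul_assoc, Finset.sum_mul]
        congr 1
        refine Finset.sum_congr rfl fun a _ => ?_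
        rw [mul_assoc, ← AddChar.map_add_eq_mul]
        congr 2
        simp only [Equiv.neg_apply, Prod.fst_neg, Prod.snd_neg]
        ring

end

section

/-! ### Cosets of the subgroups of the chain -/

variable {p : ℕ}

theorem chain_eq_iUnion (n : ℤ) : (chain p n : Set (Vilenkin p)) =
    ⋃ b : ZMod p, (fun x => -single n b + x) ⁻¹' (chain p (n + 1) : Set (Vilenkin p)) := by
  ext x
  simp only [Set.mem_iUnion, Set.mem_preimage, SetLike.mem_coe]
  constructor
  · intro hx
    refine ⟨x n, fun k hk => ?_⟩
    rw [add_coord, neg_coord]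
    by_cases h : k = n
    · subst h; rw [single_same, neg_add_cancel]
    · rw [single_of_ne h, hx k (by omega), neg_zero, zero_add]
  · rintro ⟨b, hb⟩
    have := (chain p n).add_mem (single_mem_chain le_rfl b) (chain_anti p (by omega) hb)
    rwa [add_neg_cancel_left] at this

theorem measurableSet_chain (n : ℤ) : MeasurableSet (chain p n : Set (Vilenkin p)) :=
  (isOpen_chain n).measurableSet

theorem continuous_pairing_left (x : Vilenkin p) : Continuous fun χ : X p => pairing χ x :=
  continuous_subtype_val.comp
    (continuous_eval_const (F := Multiplicative (Vilenkin p) →ₜ* Circle)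
      (Multiplicative.ofAdd x))

/-! ### The functions `1_{a + 𝔊_n} ξ` -/

/-- The function `1_{a + 𝔊_n} ξ`. -/
def cosetChar (n : ℤ) (a : Vilenkin p) (ξ : X p) : Vilenkin p → ℂ :=
  Set.indicator {x | x - a ∈ chain p n} (pairing ξ)

theorem cosetChar_of_mem {n : ℤ} {a x : Vilenkin p} (h : x - a ∈ chain p n) (ξ : X p) :
    cosetChar n a ξ x = pairing ξ x :=
  Set.indicator_of_mem (show x ∈ {x | x - a ∈ chain p n} from h) _

theorem cosetChar_of_notMem {n : ℤ} {a x : Vilenkin p} (h : x - a ∉ chain p n) (ξ : X p) :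
    cosetChar n a ξ x = 0 :=
  Set.indicator_of_notMem (show x ∉ {x | x - a ∈ chain p n} from h) _

theorem measurableSet_coset (n : ℤ) (a : Vilenkin p) :
    MeasurableSet {x : Vilenkin p | x - a ∈ chain p n} :=
  (measurableSet_chain n).preimage (measurable_sub_const a)

theorem cosetChar_congr {n : ℤ} {a b : Vilenkin p} (h : a - b ∈ chain p n) (ξ : X p) :
    cosetChar n a ξ = cosetChar n b ξ := by
  have : {x : Vilenkin p | x - a ∈ chain p n} = {x | x - b ∈ chain p n} := by
    ext x
    simp only [Set.mem_ofPred_eq]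
    rw [← sub_add_sub_cancel x a b]
    exact ((chain p n).add_mem_cancel_right h).symm
  rw [cosetChar, this, cosetChar]

theorem cosetChar_dil_sub (m n : ℤ) (ξ : X p) (h x : Vilenkin p) :
    cosetChar m 0 ξ (dil n x - h) =
      starRingEnd ℂ (pairing ξ h) * cosetChar (m + n) (dil (-n) h) (dilChar n ξ) x := by
  have e : dil n (x - dil (-n) h) = dil n x - h := by
    rw [map_sub, dil_dil, add_neg_cancel, dil_zero]
  have this : dil n x - h - 0 ∈ chain p m ↔ x - dil (-n) h ∈ chain p (m + n) := by
    rw [sub_zero, ← e, dil_mem_chain]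
  by_cases hx : x - dil (-n) h ∈ chain p (m + n)
  · rw [cosetChar_of_mem hx, cosetChar_of_mem (this.2 hx), pairing_dilChar, pairing_sub, mul_comm]
  · rw [cosetChar_of_notMem hx, cosetChar_of_notMem (fun h => hx (this.1 h)), mul_zero]

/-! ### Values of the Haar measure on the subgroups of the chain -/

variable [NeZero p]

theorem isCompact_chain (n : ℤ) : IsCompact (chain p n : Set (Vilenkin p)) := by
  have : (chain p n : Set (Vilenkin p)) = dil (-n) '' (chain p 0 : Set (Vilenkin p)) := by
    ext x
    constructor
    · intro hx
      refine ⟨dil n x, dil_mem_chain.2 (by rwa [zero_add]), ?_⟩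
      rw [dil_dil, neg_add_cancel, dil_zero]
    · rintro ⟨y, hy, rfl⟩
      exact dil_mem_chain.2 (by rwa [add_neg_cancel])
  rw [this]
  exact (isCompact_chain_zero p).image (continuous_dil _)

instance : (mu p).IsAddHaarMeasure := by unfold mu; infer_instance

theorem mu_chain_zero : mu p (chain p 0) = 1 := Measure.addHaarMeasure_self (K₀ := chainZero p)

theorem mu_chain_lt_top (n : ℤ) : mu p (chain p n) < ⊤ := (isCompact_chain n).measure_lt_top

theorem mu_chain_succ (n : ℤ) : mu p (chain p n) = p * mu p (chain p (n + 1)) := by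
  rw [chain_eq_iUnion n, measure_iUnion]
  · simp only [measure_preimage_add]
    rw [tsum_fintype, Finset.sum_const, Finset.card_univ, ZMod.card, nsmul_eq_mul]
  · intro a b hab
    refine Set.disjoint_left.2 fun x ha hb => hab ?_
    have h1 : (-single n a + x : Vilenkin p) n = 0 := ha n (by omega)
    have h2 : (-single n b + x : Vilenkin p) n = 0 := hb n (by omega)
    rw [add_coord, neg_coord, single_same, neg_add_eq_zero] at h1 h2
    rw [h1, h2]
  · exact fun b => (measurableSet_chain _).preimage (measurable_const_add _)

theorem mu_real_chain (n : ℤ) : (mu p).real (chain p n) = (p : ℝ) ^ (-n) := by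
  have hp : (p : ℝ) ≠ 0 := Nat.cast_ne_zero.2 (NeZero.ne p)
  have hs : ∀ n : ℤ, (mu p).real (chain p n) = p * (mu p).real (chain p (n + 1)) := fun n => by
    rw [measureReal_def, mu_chain_succ, ENNReal.toReal_mul, measureReal_def, ENNReal.toReal_natCast]
  induction n using Int.induction_on with
  | zero => rw [measureReal_def, mu_chain_zero]; simp
  | succ n ih =>
    rw [hs] at ih
    rw [neg_add, ← sub_eq_add_neg, zpow_sub_one₀ hp, ← ih]
    field_simp
  | pred n ih =>
    rw [hs, sub_add_cancel, ih, neg_sub, sub_neg_eq_add, neg_neg, add_comm, zpow_add_one₀ hp,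
      mul_comm]

/-! ### Haar measure on the dual group and the refinable function -/

theorem isOpen_annihilator (n : ℤ) : IsOpen (annihilator p n : Set (X p)) := by
  refine Subgroup.isOpen_of_mem_nhds _ (g := 1) ?_
  have hK : IsCompact (Multiplicative.toAdd ⁻¹' (chain p n : Set (Vilenkin p))) :=
    (isCompact_chain n)
  have h : IsOpen {χ : X p | Set.MapsTo χ (Multiplicative.toAdd ⁻¹' (chain p n : Set (Vilenkin p)))
      {z : Circle | (z : ℂ) ^ p = 1 → z = 1}} :=
    (ContinuousMap.isOpen_setOfPred_mapsTo hK isOpen_compl_roots).preimage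
      (ContinuousMonoidHom.isInducing_toContinuousMap
        (Multiplicative (Vilenkin p)) Circle).continuous
  refine Filter.mem_of_superset (h.mem_nhds ?_) ?_
  · intro x _ _
    simp
  · intro χ hχ x hx
    have := hχ (x := Multiplicative.ofAdd x) hx (pairing_pow χ x)
    simp only [pairing, this, Circle.coe_one]

theorem measurableSet_annihilator (n : ℤ) : MeasurableSet (annihilator p n : Set (X p)) :=
  (isOpen_annihilator n).measurableSet

/-- `𝔊_0^⊥` is the image of the dual of the discrete group `𝔊 / 𝔊_0`. -/
theorem isCompact_annihilator_zero : IsCompact (annihilator p 0 : Set (X p)) := by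
  let S : Subgroup (Multiplicative (Vilenkin p)) := AddSubgroup.toSubgroup (chain p 0)
  have hS : IsOpen (S : Set (Multiplicative (Vilenkin p))) := isOpen_chain 0
  have : DiscreteTopology (Multiplicative (Vilenkin p) ⧸ S) := QuotientGroup.discreteTopology hS
  let π : Multiplicative (Vilenkin p) →ₜ* (Multiplicative (Vilenkin p) ⧸ S) :=
    { QuotientGroup.mk' S with continuous_toFun := continuous_quot_mk }
  have hr : (annihilator p 0 : Set (X p)) ⊆ Set.range (PontryaginDual.map π) := by
    intro χ hχ
    have hle : S ≤ (χ : Multiplicative (Vilenkin p) →* Circle).ker := fun x hx =>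
      Circle.coe_injective (hχ x.toAdd hx)
    let ξ : (Multiplicative (Vilenkin p) ⧸ S) →ₜ* Circle :=
      { QuotientGroup.lift S (χ : Multiplicative (Vilenkin p) →* Circle) hle with
        continuous_toFun := continuous_of_discreteTopology }
    exact ⟨ξ, PontryaginDual.ext fun x => rfl⟩
  exact (isCompact_range (map_continuous (PontryaginDual.map π))).of_isClosed_subset
    (Subgroup.isClosed_of_isOpen _ (isOpen_annihilator 0)) hr

theorem haar_annihilator_zero_ne_zero :
    (Measure.haar : Measure (X p)) (annihilator p 0) ≠ 0 :=
  (isOpen_annihilator 0).measure_ne_zero _ ⟨1, one_mem _⟩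

theorem nu_annihilator_zero : nu p (annihilator p 0) = 1 := by
  rw [nu, Measure.smul_apply, smul_eq_mul]
  exact ENNReal.inv_mul_cancel haar_annihilator_zero_ne_zero
    isCompact_annihilator_zero.measure_lt_top.ne

instance : (nu p).IsMulLeftInvariant := by unfold nu; infer_instance

theorem annihilator_eq_iUnion (n : ℤ) : (annihilator p (n + 1) : Set (X p)) =
    ⋃ b : ZMod p, (fun χ => (rademacher p n ^ b.val)⁻¹ * χ) ⁻¹'
      (annihilator p n : Set (X p)) := by
  ext χ
  simp only [Set.mem_iUnion, Set.mem_preimage, SetLike.mem_coe, mem_annihilator_iff, digit_mul,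
    digit_inv, digit_pow, digit_rademacher]
  constructor
  · intro h
    refine ⟨digit χ n, fun k hk => ?_⟩
    by_cases hkn : k = n
    · subst hkn; simp
    · rw [if_neg hkn, h k (by omega)]; simp
  · rintro ⟨b, hb⟩ k hk
    have := hb k (by omega)
    rwa [if_neg (by omega), mul_zero, neg_zero, zero_add] at this

theorem nu_annihilator_succ (n : ℤ) :
    nu p (annihilator p (n + 1)) = p * nu p (annihilator p n) := by
  rw [annihilator_eq_iUnion n, measure_iUnion]
  · simp only [measure_preimage_mul]
    rw [tsum_fintype, Finset.sum_const, Finset.card_univ, ZMod.card, nsmul_eq_mul]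
  · intro a b hab
    refine Set.disjoint_left.2 fun χ ha hb => hab ?_
    have h1 := mem_annihilator_iff.1 ha n le_rfl
    have h2 := mem_annihilator_iff.1 hb n le_rfl
    rw [digit_mul, digit_inv, digit_pow, digit_rademacher, if_pos rfl, mul_one,
      neg_add_eq_zero] at h1 h2
    simpa using h1.trans h2.symm
  · exact fun b => (measurableSet_annihilator _).preimage (measurable_const_mul _)

theorem nu_real_annihilator : (nu p).real (annihilator p (-1)) = 1 / p := by
  have h := nu_annihilator_succ (p := p) (-1)
  rw [neg_add_cancel, nu_annihilator_zero] at h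
  have := congrArg ENNReal.toReal h
  rw [ENNReal.toReal_mul, ENNReal.toReal_natCast, ENNReal.toReal_one] at this
  rw [measureReal_def, eq_div_iff (Nat.cast_ne_zero.2 (NeZero.ne p)), this, mul_comm]

theorem nu_annihilator_lt_top : nu p (annihilator p (-1)) < ⊤ := by
  refine lt_of_le_of_lt (measure_mono (t := (annihilator p 0 : Set (X p))) fun χ hχ => ?_)
    (nu_annihilator_zero (p := p) ▸ ENNReal.one_lt_top)
  exact fun x hx => hχ x (chain_anti p (by norm_num) hx)

theorem integrable_indicator_annihilator (u : ℂ) (ξ : X p) (x : Vilenkin p) :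
    Integrable (fun χ => (annihilator p (-1) : Set (X p)).indicator (fun _ => u) (ξ⁻¹ * χ)
      * pairing χ x) (nu p) := by
  refine Integrable.mul_bdd (c := 1) ?_ (continuous_pairing_left x).aestronglyMeasurable
    (Filter.Eventually.of_forall fun χ => (norm_pairing χ x).le)
  exact ((integrable_indicator_iff (measurableSet_annihilator _)).2
    (integrableOn_const nu_annihilator_lt_top.ne)).comp_mul_left ξ⁻¹

/-- The inverse Fourier transform of the indicator function of `ξ 𝔊_{-1}^⊥`. -/
theorem integral_indicator_annihilator (u : ℂ) (ξ : X p) (x : Vilenkin p) :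
    ∫ χ, (annihilator p (-1) : Set (X p)).indicator (fun _ => u) (ξ⁻¹ * χ) * pairing χ x ∂(nu p)
      = 1 / p * (u * cosetChar (-1) 0 ξ x) := by
  have h1 : ∀ η : X p, ∫ χ, (annihilator p (-1) : Set (X p)).indicator (fun _ => u) (ξ⁻¹ * χ)
      * pairing χ x ∂(nu p) = ∫ χ, (annihilator p (-1) : Set (X p)).indicator (fun _ => u)
        (ξ⁻¹ * (η * χ)) * pairing (η * χ) x ∂(nu p) := fun η =>
    (integral_mul_left_eq_self (μ := nu p) (fun χ =>
      (annihilator p (-1) : Set (X p)).indicator (fun _ => u) (ξ⁻¹ * χ) * pairing χ x) η).symm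
  by_cases hx : x ∈ chain p (-1)
  · rw [h1 ξ, cosetChar_of_mem (by rwa [sub_zero])]
    have : ∀ χ : X p, (annihilator p (-1) : Set (X p)).indicator (fun _ => u) (ξ⁻¹ * (ξ * χ))
        * pairing (ξ * χ) x = (annihilator p (-1) : Set (X p)).indicator
          (fun _ => u * pairing ξ x) χ := by
      intro χ
      rw [inv_mul_cancel_left]
      by_cases hχ : χ ∈ annihilator p (-1)
      · rw [Set.indicator_of_mem hχ, Set.indicator_of_mem hχ, pairing_mul, hχ x hx, mul_one]
      · rw [Set.indicator_of_notMem hχ, Set.indicator_of_notMem hχ, zero_mul]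
    simp only [this]
    rw [integral_indicator_const _ (measurableSet_annihilator _), nu_real_annihilator]
    simp
  · rw [cosetChar_of_notMem (by rwa [sub_zero]), mul_zero, mul_zero]
    obtain ⟨k, hk, hxk⟩ : ∃ k < (-1 : ℤ), x k ≠ 0 := by
      by_contra! h
      exact hx h
    -- the translation by `r_k ∈ 𝔊_{-1}^⊥` multiplies the integral by `(r_k, x) ≠ 1`
    have h2 := h1 (rademacher p k)
    have : ∀ χ : X p, (annihilator p (-1) : Set (X p)).indicator (fun _ => u)
        (ξ⁻¹ * (rademacher p k * χ)) * pairing (rademacher p k * χ) x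
        = pairing (rademacher p k) x * ((annihilator p (-1) : Set (X p)).indicator (fun _ => u)
          (ξ⁻¹ * χ) * pairing χ x) := by
      intro χ
      have hk' : rademacher p k ∈ annihilator p (-1) := mem_annihilator_iff.2 fun j hj => by
        rw [digit_rademacher, if_neg (by omega)]
      classical
      rw [mul_left_comm, pairing_mul]
      have : rademacher p k * (ξ⁻¹ * χ) ∈ (annihilator p (-1) : Set (X p)) ↔
          ξ⁻¹ * χ ∈ (annihilator p (-1) : Set (X p)) := Subgroup.mul_mem_cancel_left _ hk'
      rw [Set.indicator_apply, Set.indicator_apply, if_congr this rfl rfl]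
      ring
    simp only [this] at h2
    rw [integral_const_mul] at h2
    have h3 : pairing (rademacher p k) x ≠ 1 := by
      rw [pairing_rademacher_eq, ← (ZMod.stdAddChar (N := p)).map_zero_eq_one]
      exact fun h => hxk (ZMod.injective_stdAddChar h)
    by_contra h0
    exact h3 (mul_right_cancel₀ h0 (by rw [one_mul]; exact h2.symm))

variable {par : ZMod p → ZMod p} {N : ℕ} {lam : ZMod p → ZMod p → ℂ}

theorem IsParentMap.phi_eq (H : IsParentMap par N lam) (x : Vilenkin p) :
    phi lam x = 1 / p *
      ∑ b, pathWeight par N lam b * cosetChar (-1) 0 (pathChar par N (-1) b) x := by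
  rw [phi]
  simp only [H.phiHat_eq, Finset.sum_mul]
  rw [integral_finsetSum _ fun b _ => integrable_indicator_annihilator _ _ _, Finset.mul_sum]
  exact Finset.sum_congr rfl fun b _ => integral_indicator_annihilator _ _ _

end

section

variable {p : ℕ} [NeZero p]

/-! ### The functions `1_{a + 𝔊_n} ξ` in `L₂(𝔊)` -/

/-- Splitting a coset of `𝔊_{n+1}` off a coset of `𝔊_n` by means of the characters `r_n^b`. -/
theorem cosetChar_succ (n : ℤ) (a : Vilenkin p) (ξ : X p) (x : Vilenkin p) :
    cosetChar (n + 1) a ξ x = 1 / p * ∑ b : ZMod p,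
      starRingEnd ℂ (pairing (rademacher p n ^ b.val) a) *
        cosetChar n a (rademacher p n ^ b.val * ξ) x := by
  have hp : (p : ℂ) ≠ 0 := Nat.cast_ne_zero.2 (NeZero.ne p)
  by_cases hx : x - a ∈ chain p n
  · have h1 : ∀ b : ZMod p, starRingEnd ℂ (pairing (rademacher p n ^ b.val) a) *
        cosetChar n a (rademacher p n ^ b.val * ξ) x
        = pairing ξ x * ZMod.stdAddChar (b * (x - a) n) := by
      intro b
      have h2 : pairing (rademacher p n ^ b.val) (x - a) = ZMod.stdAddChar (b * (x - a) n) := by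
        have h3 : ∀ m : ℕ, pairing (rademacher p n ^ m) (x - a)
            = ZMod.stdAddChar ((m : ZMod p) * (x - a) n) := by
          intro m
          induction m with
          | zero => simp [pairing_one]
          | succ m ih =>
            rw [pow_succ, pairing_mul, ih, pairing_rademacher_eq, ← AddChar.map_add_eq_mul]
            congr 1; push_cast; ring
        rw [h3]; simp
      rw [cosetChar_of_mem hx, pairing_mul, ← h2, pairing_sub]
      ring
    simp only [h1]
    rw [← Finset.mul_sum, sum_stdAddChar]
    have h2 : x - a ∈ chain p (n + 1) ↔ (x - a) n = 0 := by
      refine ⟨fun h => h n (by omega), fun h k hk => ?_⟩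
      rcases eq_or_ne k n with rfl | hkn
      · exact h
      · exact hx k (by omega)
    by_cases h3 : (x - a) n = 0
    · rw [cosetChar_of_mem (h2.2 h3), if_pos h3]
      field_simp
    · rw [cosetChar_of_notMem (fun h => h3 (h2.1 h)), if_neg h3, mul_zero, mul_zero]
  · have h1 : x - a ∉ chain p (n + 1) := fun h => hx (chain_anti p (by omega) h)
    simp [cosetChar_of_notMem hx, cosetChar_of_notMem h1]

theorem mu_coset (n : ℤ) (a : Vilenkin p) : mu p {x | x - a ∈ chain p n} = mu p (chain p n) := by
  simp only [sub_eq_add_neg]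
  exact measure_preimage_add_right (mu p) (-a) (chain p n : Set (Vilenkin p))

theorem memLp_cosetChar (n : ℤ) (a : Vilenkin p) (ξ : X p) (q : ENNReal) :
    MemLp (cosetChar n a ξ) q (mu p) := by
  rw [cosetChar, memLp_indicator_iff_restrict (measurableSet_coset n a)]
  have : IsFiniteMeasure ((mu p).restrict {x | x - a ∈ chain p n}) :=
    ⟨by rw [Measure.restrict_apply_univ, mu_coset]; exact mu_chain_lt_top n⟩
  exact MemLp.of_bound (continuous_pairing ξ).aestronglyMeasurable 1
    (Filter.Eventually.of_forall fun x => (norm_pairing ξ x).le)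

theorem integral_cosetChar_one (n : ℤ) (a : Vilenkin p) :
    ∫ x, cosetChar n a 1 x ∂(mu p) = (p : ℂ) ^ (-n) := by
  have : cosetChar n a (1 : X p) = Set.indicator {x | x - a ∈ chain p n} (fun _ => (1 : ℂ)) := by
    rw [cosetChar]
    congr 1
  rw [this, integral_indicator_const _ (measurableSet_coset n a), measureReal_def, mu_coset,
    ← measureReal_def, mu_real_chain]
  simp

theorem integral_cosetChar_eq_zero {n : ℤ} {ξ : X p} (h : ξ ∉ annihilator p n) (a : Vilenkin p) :
    ∫ x, cosetChar n a ξ x ∂(mu p) = 0 := by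
  obtain ⟨y, hy, hne⟩ : ∃ y ∈ chain p n, pairing ξ y ≠ 1 := by
    by_contra! h'
    exact h h'
  have h1 := integral_add_left_eq_self (μ := mu p) (cosetChar n a ξ) y
  have h2 : ∀ x, cosetChar n a ξ (y + x) = pairing ξ y * cosetChar n a ξ x := by
    intro x
    have : y + x - a ∈ chain p n ↔ x - a ∈ chain p n := by
      rw [add_sub_assoc]; exact (chain p n).add_mem_cancel_left hy
    by_cases hx : x - a ∈ chain p n
    · rw [cosetChar_of_mem hx, cosetChar_of_mem (this.2 hx), pairing_add]
    · rw [cosetChar_of_notMem hx, cosetChar_of_notMem (fun h => hx (this.1 h)), mul_zero]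
  simp only [h2] at h1
  rw [integral_const_mul] at h1
  by_contra h0
  exact hne (mul_right_cancel₀ h0 (by rw [one_mul]; exact h1))

/-- The element `1_{a + 𝔊_n} ξ` of `L₂(𝔊)`. -/
def cosetVec (n : ℤ) (a : Vilenkin p) (ξ : X p) : L2 p := (memLp_cosetChar n a ξ 2).toLp

theorem coeFn_cosetVec (n : ℤ) (a : Vilenkin p) (ξ : X p) :
    cosetVec n a ξ =ᵐ[mu p] cosetChar n a ξ := MemLp.coeFn_toLp _

theorem cosetVec_congr {n : ℤ} {a b : Vilenkin p} (h : a - b ∈ chain p n) (ξ : X p) :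
    cosetVec n a ξ = cosetVec n b ξ := by
  simp only [cosetVec, cosetChar_congr h]

theorem inner_cosetVec {m n : ℤ} (hnm : n ≤ m) (a b : Vilenkin p) (ξ η : X p)
    [Decidable (b - a ∈ chain p n)] :
    inner ℂ (cosetVec n a ξ) (cosetVec m b η) =
      if b - a ∈ chain p n then ∫ x, cosetChar m b (ξ⁻¹ * η) x ∂(mu p) else 0 := by
  rw [L2.inner_def]
  have h : ∀ x, inner ℂ (cosetChar n a ξ x) (cosetChar m b η x) =
      if b - a ∈ chain p n then cosetChar m b (ξ⁻¹ * η) x else 0 := by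
    intro x
    rw [RCLike.inner_apply]
    by_cases hx : x - b ∈ chain p m
    · have : x - a ∈ chain p n ↔ b - a ∈ chain p n := by
        rw [← sub_add_sub_cancel x b a]
        exact (chain p n).add_mem_cancel_left (chain_anti p hnm hx)
      split_ifs with hab
      · rw [cosetChar_of_mem hx, cosetChar_of_mem (this.2 hab), cosetChar_of_mem hx, pairing_mul,
          pairing_inv, mul_comm]
      · rw [cosetChar_of_notMem (fun h => hab (this.1 h)), map_zero, mul_zero]
    · rw [cosetChar_of_notMem hx, cosetChar_of_notMem hx, zero_mul, ite_self]
  rw [integral_congr_ae (g := fun x => if b - a ∈ chain p n then cosetChar m b (ξ⁻¹ * η) x else 0)]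
  · split_ifs <;> simp
  · filter_upwards [coeFn_cosetVec n a ξ, coeFn_cosetVec m b η] with x h1 h2
    rw [h1, h2, h]

theorem inner_cosetVec_eq_zero {m n : ℤ} (hnm : n ≤ m) (a b : Vilenkin p) {ξ η : X p} {k : ℤ}
    (hk : m ≤ k) (h : digit ξ k ≠ digit η k) :
    inner ℂ (cosetVec n a ξ) (cosetVec m b η) = 0 := by
  classical
  rw [inner_cosetVec hnm, integral_cosetChar_eq_zero, ite_self]
  intro h'
  have := mem_annihilator_iff.1 h' k hk
  rw [digit_mul, digit_inv, neg_add_eq_zero] at this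
  exact h this

theorem inner_cosetVec_same (n : ℤ) (a b : Vilenkin p) (ξ : X p) [Decidable (b - a ∈ chain p n)] :
    inner ℂ (cosetVec n a ξ) (cosetVec n b ξ) =
      if b - a ∈ chain p n then (p : ℂ) ^ (-n) else 0 := by
  rw [inner_cosetVec le_rfl, inv_mul_cancel, integral_cosetChar_one]

theorem norm_cosetVec (n : ℤ) (a : Vilenkin p) (ξ : X p) :
    ‖cosetVec n a ξ‖ ^ 2 = (p : ℝ) ^ (-n) := by
  classical
  have h := inner_self_eq_norm_sq_to_K (𝕜 := ℂ) (cosetVec n a ξ)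
  rw [inner_cosetVec_same, if_pos (by rw [sub_self]; exact zero_mem _)] at h
  apply Complex.ofReal_injective
  push_cast
  exact h.symm

theorem coeFn_sum_smul {ι : Type*} (s : Finset ι) (c : ι → ℂ) {v : ι → L2 p}
    {g : ι → Vilenkin p → ℂ} (hv : ∀ i, v i =ᵐ[mu p] g i) :
    (∑ i ∈ s, c i • v i : L2 p) =ᵐ[mu p] fun x => ∑ i ∈ s, c i * g i x := by
  classical
  induction s using Finset.induction_on with
  | empty => simp only [Finset.sum_empty]; exact Lp.coeFn_zero ℂ 2 (mu p)
  | insert i s hi ih =>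
    rw [Finset.sum_insert hi]
    filter_upwards [ih, Lp.coeFn_add (c i • v i) (∑ i ∈ s, c i • v i), Lp.coeFn_smul (c i) (v i),
      hv i] with x h1 h2 h3 h4
    rw [h2, Pi.add_apply, h1, h3, Pi.smul_apply, h4, Finset.sum_insert hi, smul_eq_mul]

theorem cosetVec_succ (n : ℤ) (a : Vilenkin p) (ξ : X p) :
    cosetVec (n + 1) a ξ = (1 / p : ℂ) • ∑ b : ZMod p,
      starRingEnd ℂ (pairing (rademacher p n ^ b.val) a) •
        cosetVec n a (rademacher p n ^ b.val * ξ) := by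
  refine Lp.ext ?_
  filter_upwards [coeFn_cosetVec (n + 1) a ξ, Lp.coeFn_smul (1 / p : ℂ) (∑ b : ZMod p,
      starRingEnd ℂ (pairing (rademacher p n ^ b.val) a) •
        cosetVec n a (rademacher p n ^ b.val * ξ)), coeFn_sum_smul Finset.univ
      (fun b : ZMod p => starRingEnd ℂ (pairing (rademacher p n ^ b.val) a))
      (fun b => coeFn_cosetVec n a (rademacher p n ^ b.val * ξ))] with x h1 h2 h3
  rw [h1, h2, Pi.smul_apply, h3, cosetChar_succ, smul_eq_mul]

end

section

variable {p : ℕ}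

/-! ### Totality of the indicator functions of cosets -/

theorem exists_H0_sub_mem_chain (x : Vilenkin p) : ∃ h ∈ H0 p, x - h ∈ chain p 0 := by
  refine ⟨⟨fun n => if n < 0 then x n else 0, ?_⟩, ?_, ?_⟩
  · obtain ⟨m, hm⟩ := x.2
    refine ⟨m, fun n hn => ?_⟩
    exact ite_eq_right_iff.2 fun _ => hm n hn
  · exact fun n hn => if_neg (by omega)
  · intro k hk
    change x.1 k - (if k < 0 then x.1 k else 0) = 0
    rw [if_pos hk, sub_self]

/-- The cosets of the subgroups `𝔊_n`, with representatives in the countable set `𝒜^{-n} H_0`. -/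
def cosets (p : ℕ) : Set (Set (Vilenkin p)) :=
  Set.range fun q : ℤ × H0 p => {x | x - dil (-q.1) (q.2 : Vilenkin p) ∈ chain p q.1}

theorem exists_coset_eq (n : ℤ) (a : Vilenkin p) :
    ∃ h ∈ H0 p, a - dil (-n) h ∈ chain p n := by
  obtain ⟨h, hh, hm⟩ := exists_H0_sub_mem_chain (dil n a)
  refine ⟨h, hh, ?_⟩
  have : dil n (a - dil (-n) h) = dil n a - h := by
    rw [map_sub, dil_dil, add_neg_cancel, dil_zero]
  rw [← this, dil_mem_chain, zero_add] at hm
  exact hm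

theorem isTopologicalBasis_cosets : TopologicalSpace.IsTopologicalBasis (cosets p) := by
  refine TopologicalSpace.isTopologicalBasis_of_isOpen_of_nhds ?_ ?_
  · rintro _ ⟨⟨n, h⟩, rfl⟩
    exact (isOpen_chain n).preimage (continuous_sub_right _)
  · intro a U ha hU
    obtain ⟨n, -, hn⟩ := (nhds_hasBasis a).mem_iff.1 (hU.mem_nhds ha)
    obtain ⟨h, hh, hm⟩ := exists_coset_eq n a
    refine ⟨_, ⟨(n, ⟨h, hh⟩), rfl⟩, hm, fun y hy => hn ?_⟩
    have := (chain p n).sub_mem hy hm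
    rwa [sub_sub_sub_cancel_right] at this

theorem isPiSystem_cosets : IsPiSystem (cosets p) := by
  have key : ∀ (m n : ℤ) (a b x : Vilenkin p), m ≤ n → x - a ∈ chain p m → x - b ∈ chain p n →
      {x | x - a ∈ chain p m} ∩ {x | x - b ∈ chain p n} = {x | x - b ∈ chain p n} := by
    intro m n a b x hmn ha hb
    refine Set.inter_eq_right.2 fun y hy => ?_
    have h1 := (chain p m).add_mem (chain_anti p hmn ((chain p n).sub_mem hy hb)) ha
    have h2 : y - b - (x - b) + (x - a) = y - a := by abel
    rwa [h2] at h1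
  rintro _ ⟨⟨m, a⟩, rfl⟩ _ ⟨⟨n, b⟩, rfl⟩ ⟨x, hxa, hxb⟩
  rcases le_total m n with h | h
  · exact ⟨(n, b), (key m n _ _ x h hxa hxb).symm⟩
  · exact ⟨(m, a), by rw [Set.inter_comm]; exact (key n m _ _ x h hxb hxa).symm⟩

theorem exists_mem_chain_neg (x : Vilenkin p) : ∃ m : ℕ, x ∈ chain p (-(m : ℤ)) := by
  obtain ⟨m, hm⟩ := x.2
  exact ⟨(-m).toNat, fun k hk => hm k (by omega)⟩

variable [NeZero p]

theorem countable_H0 : (H0 p).Countable := by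
  have : H0 p ⊆ ⋃ s : ℕ, H0s p s := by
    intro h hh
    obtain ⟨m, hm⟩ := h.2
    refine Set.mem_iUnion.2 ⟨(-m).toNat, fun n hn => ?_⟩
    rcases hn with hn | hn
    · exact hh n hn
    · exact hm n (by omega)
  exact (Set.countable_iUnion fun s => (Set.toFinite (H0s p s)).countable).mono this

theorem countable_cosets : (cosets p).Countable := by
  have := (countable_H0 (p := p)).to_subtype
  exact Set.countable_range _

theorem borel_eq_generateFrom_cosets :
    (inferInstance : MeasurableSpace (Vilenkin p)) = MeasurableSpace.generateFrom (cosets p) := by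
  have : SecondCountableTopology (Vilenkin p) :=
    isTopologicalBasis_cosets.secondCountableTopology countable_cosets
  exact isTopologicalBasis_cosets.borel_eq_generateFrom

/-- An element of `L₂(𝔊)` orthogonal to the indicator functions of all cosets vanishes: the cosets
form a `π`-system which generates the Borel sets. -/
theorem eq_zero_of_inner_cosetVec_one (f : L2 p)
    (hf : ∀ (n : ℤ) (a : Vilenkin p), inner ℂ (cosetVec n a 1) f = 0) : f = 0 := by
  have hint : ∀ (n : ℤ) (a : Vilenkin p), IntegrableOn f {x | x - a ∈ chain p n} (mu p) := by
    intro n a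
    have : IsFiniteMeasure ((mu p).restrict {x | x - a ∈ chain p n}) :=
      ⟨by rw [Measure.restrict_apply_univ, mu_coset]; exact mu_chain_lt_top n⟩
    exact ((Lp.memLp f).restrict _).integrable (by norm_num)
  have hzero : ∀ (n : ℤ) (a : Vilenkin p), ∫ x in {x | x - a ∈ chain p n}, f x ∂(mu p) = 0 := by
    intro n a
    rw [← hf n a, L2.inner_def, ← integral_indicator (measurableSet_coset n a)]
    refine integral_congr_ae ?_
    filter_upwards [coeFn_cosetVec n a 1] with x hx
    rw [hx, RCLike.inner_apply]
    by_cases h : x - a ∈ chain p n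
    · rw [cosetChar_of_mem h, pairing_one, map_one, mul_one]
      exact Set.indicator_of_mem (show x ∈ {x | x - a ∈ chain p n} from h) _
    · rw [cosetChar_of_notMem h, map_zero, mul_zero]
      exact Set.indicator_of_notMem (show x ∉ {x | x - a ∈ chain p n} from h) _
  have hchain : ∀ m : ℤ, {x : Vilenkin p | x - 0 ∈ chain p m} = chain p m := fun m => by
    ext x; simp
  have hall : ∀ (m : ℤ) (s : Set (Vilenkin p)), MeasurableSet s →
      ∫ x in s ∩ chain p m, f x ∂(mu p) = 0 := by
    intro m s hs
    have hm : IntegrableOn f (chain p m) (mu p) := hchain m ▸ hint m 0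
    have hm0 : ∫ x in chain p m, f x ∂(mu p) = 0 := hchain m ▸ hzero m 0
    refine MeasurableSpace.induction_on_inter
      (C := fun s _ => ∫ x in s ∩ chain p m, f x ∂(mu p) = 0) borel_eq_generateFrom_cosets
      isPiSystem_cosets ?_ (fun t ht => ?_) (fun t ht ih => ?_) (fun g hd hg ih => ?_) s hs
    · simp
    · rcases Set.eq_empty_or_nonempty (t ∩ chain p m) with h | h
      · rw [h]; simp
      · obtain ⟨h0, hh0, hz⟩ := exists_coset_eq m (0 : Vilenkin p)
        have hc : (chain p m : Set (Vilenkin p)) ∈ cosets p := by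
          refine ⟨(m, ⟨h0, hh0⟩), ?_⟩
          ext x
          change x - dil (-m) h0 ∈ chain p m ↔ x ∈ chain p m
          rw [zero_sub] at hz
          rw [sub_eq_add_neg]
          exact (chain p m).add_mem_cancel_right hz
        obtain ⟨q, hq⟩ := isPiSystem_cosets t ht _ hc h
        rw [← hq]
        exact hzero _ _
    · have h1 := integral_inter_add_sdiff (μ := mu p) (s := (chain p m : Set (Vilenkin p))) ht hm
      rw [Set.inter_comm, ih, hm0, zero_add] at h1
      rw [Set.inter_comm, ← Set.sdiff_eq]
      exact h1
    · rw [Set.iUnion_inter, integral_iUnion]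
      · simp [ih]
      · exact fun i => (hg i).inter (measurableSet_chain m)
      · exact fun i j hij => (hd hij).mono Set.inter_subset_left Set.inter_subset_left
      · exact hm.mono_set (Set.iUnion_subset fun i => Set.inter_subset_right)
  have hae : ∀ m : ℕ, ∀ᵐ x ∂(mu p), x ∈ chain p (-(m : ℤ)) → f x = 0 := by
    intro m
    refine (ae_restrict_iff' (measurableSet_chain _)).1 ?_
    refine Integrable.ae_eq_zero_of_forall_setIntegral_eq_zero (hchain _ ▸ hint (-(m : ℤ)) 0) ?_
    intro s hs _
    rw [Measure.restrict_restrict hs]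
    exact hall _ s hs
  refine Lp.ext ?_
  filter_upwards [ae_all_iff.2 hae, Lp.coeFn_zero ℂ 2 (mu p)] with x hx h0
  obtain ⟨m, hm⟩ := exists_mem_chain_neg x
  rw [hx m hm, h0, Pi.zero_apply]

end

section

variable {p : ℕ} {par : ZMod p → ZMod p} {N : ℕ} {lam : ZMod p → ZMod p → ℂ}

/-! ### The translation set `H_0` -/

theorem eq_single_of_mem_chain {x : Vilenkin p} (hx : x ∈ chain p (-1)) (h0 : x ∈ H0 p) :
    x = single (-1) (x (-1)) := by
  refine Vilenkin.ext fun n => ?_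
  by_cases hn : n = -1
  · subst hn; rw [single_same]
  · rw [single_of_ne hn]
    rcases lt_or_ge n (-1) with h | h
    · exact hx n h
    · exact h0 n (by omega)

theorem add_mem_H0 {x y : Vilenkin p} (hx : x ∈ H0 p) (hy : y ∈ H0 p) : x + y ∈ H0 p :=
  fun n hn => by rw [add_coord, hx n hn, hy n hn, add_zero]

theorem sub_mem_H0 {x y : Vilenkin p} (hx : x ∈ H0 p) (hy : y ∈ H0 p) : x - y ∈ H0 p :=
  fun n hn => by rw [sub_coord, hx n hn, hy n hn, sub_zero]

theorem single_mem_H0 (t : ZMod p) : single (-1) t ∈ H0 p :=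
  fun n hn => single_of_ne (by omega) t

theorem dil_sub_mem_chain (n : ℤ) (h k : Vilenkin p) :
    dil (-n) k - dil (-n) h ∈ chain p (n - 1) ↔ k - h ∈ chain p (-1) := by
  rw [← map_sub, dil_mem_chain]
  have : n - 1 + -n = -1 := by ring
  rw [this]

/-! ### The wavelets as combinations of functions `1_{a + 𝔊_n} ξ` -/

/-- The value of `ψ̂_l` on the coset of `𝔊_{-1}^⊥` with digits `b, par b + l, par (par b + l), …`
from place `-1` on. -/
def waveWeight (par : ZMod p → ZMod p) (N : ℕ) (lam : ZMod p → ZMod p → ℂ) (l b : ZMod p) : ℂ :=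
  lam b (par b) * pathWeight par N lam (par b + l)

theorem IsParentMap.norm_waveWeight (H : IsParentMap par N lam) (l b : ZMod p) :
    ‖waveWeight par N lam l b‖ = 1 := by
  rw [waveWeight, norm_mul, H.norm_lam, H.norm_pathWeight, one_mul]

variable [NeZero p] {β : H0s p 2 → ℂ}

theorem IsParentMap.psi_eq (H : IsParentMap par N lam) (hβ : IsMaskCoeff lam β) (l : ℕ)
    (x : Vilenkin p) : psi lam β l x = 1 / p * ∑ b : ZMod p, waveWeight par N lam l b *
      cosetChar (-1) 0 (branchChar par N 0 b (par b + l)) x := by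
  -- the values of `φ(𝒜x - h)`, with the cosets of `𝔊_0` split off cosets of `𝔊_{-1}`
  have h1 : ∀ h : H0s p 2, phi lam (dil 1 x - h) = 1 / p * ∑ i : ZMod p, 1 / p * ∑ b : ZMod p,
      pathWeight par N lam i * (starRingEnd ℂ (pairing (branchChar par N 0 b i) (dil (-1) h)) *
        cosetChar (-1) 0 (branchChar par N 0 b i) x) := by
    intro h
    have hm : dil (-1) (h : Vilenkin p) - 0 ∈ chain p (-1) := by
      rw [sub_zero, dil_mem_chain]
      exact fun k hk => h.2 k (Or.inr (by push_cast; omega))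
    rw [H.phi_eq]
    congr 1
    refine Finset.sum_congr rfl fun i _ => ?_
    have h2 : pairing (pathChar par N (-1) i) (h : Vilenkin p)
        = pairing (pathChar par N 0 i) (dil (-1) (h : Vilenkin p)) := by
      have : pathChar par N 0 i = dilChar 1 (pathChar par N (-1) i) := by
        rw [dilChar_pathChar]; norm_num
      rw [this, pairing_dilChar, dil_dil, add_neg_cancel, dil_zero]
    rw [cosetChar_dil_sub, cosetChar_succ, dilChar_pathChar, h2]
    simp only [cosetChar_congr hm, Finset.mul_sum]
    refine Finset.sum_congr rfl fun b _ => ?_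
    have h3 : branchChar par N 0 b i = rademacher p (-1) ^ b.val * pathChar par N 0 i := rfl
    rw [h3, neg_add_cancel, pairing_mul, map_mul]
    ring
  -- the sum over `h` is a value of the mask
  have h4 : ∀ b i : ZMod p, ∑ h : H0s p 2, waveletCoeff β l h *
      starRingEnd ℂ (pairing (branchChar par N 0 b i) (dil (-1) h)) = p * lam b (i - l) := by
    intro b i
    have hp : (p : ℂ) ≠ 0 := Nat.cast_ne_zero.2 (NeZero.ne p)
    have h5 := hβ (branchChar par N 0 b i * (rademacher p 0 ^ l)⁻¹)
    have d1 := H.digit_branchChar 0 0 b i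
    have d2 := digit_branchChar_pred (par := par) (N := N) 0 b i
    simp only [Nat.cast_zero, add_zero, Function.iterate_zero, id, zero_sub] at d1 d2
    rw [mask_eq, digit_mul, digit_mul, d1, d2, digit_inv, digit_inv, digit_pow, digit_pow,
      digit_rademacher, digit_rademacher, if_pos rfl, if_neg (by norm_num), mul_zero, neg_zero,
      add_zero, mul_one, ← sub_eq_add_neg] at h5
    rw [h5, ← mul_assoc, mul_one_div_cancel hp, one_mul]
    refine Finset.sum_congr rfl fun h _ => ?_
    rw [waveletCoeff, pairing_dilChar, pairing_mul, pairing_inv, map_mul, Complex.conj_conj]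
    ring
  have hp : (p : ℂ) ≠ 0 := Nat.cast_ne_zero.2 (NeZero.ne p)
  calc psi lam β l x
      = ∑ h : H0s p 2, ∑ b : ZMod p, ∑ i : ZMod p, 1 / p * (1 / p) * (pathWeight par N lam i *
        cosetChar (-1) 0 (branchChar par N 0 b i) x) * (waveletCoeff β l h *
        starRingEnd ℂ (pairing (branchChar par N 0 b i) (dil (-1) h))) := by
        rw [psi]
        refine Finset.sum_congr rfl fun h _ => ?_
        rw [h1, Finset.sum_comm, Finset.mul_sum, Finset.mul_sum]
        refine Finset.sum_congr rfl fun i _ => ?_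
        rw [Finset.mul_sum, Finset.mul_sum, Finset.mul_sum]
        refine Finset.sum_congr rfl fun b _ => ?_
        ring
    _ = ∑ b : ZMod p, ∑ i : ZMod p, 1 / p * (pathWeight par N lam i *
        cosetChar (-1) 0 (branchChar par N 0 b i) x) * lam b (i - l) := by
        rw [Finset.sum_comm]
        refine Finset.sum_congr rfl fun b _ => ?_
        rw [Finset.sum_comm]
        refine Finset.sum_congr rfl fun i _ => ?_
        rw [← Finset.mul_sum, h4]
        field_simp
    _ = _ := by
        rw [Finset.mul_sum]
        refine Finset.sum_congr rfl fun b _ => ?_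
        rw [Finset.sum_eq_single (par b + l)]
        · rw [add_sub_cancel_right, waveWeight]; ring
        · intro i _ hi
          rw [H.lam_eq_zero b (i - l) (fun h => hi (sub_eq_iff_eq_add.1 h)), mul_zero]
        · simp

/-- The refinement equation: `φ` is the wavelet with index `0`. -/
theorem IsParentMap.phi_eq_psi (H : IsParentMap par N lam) (hβ : IsMaskCoeff lam β)
    (x : Vilenkin p) : phi lam x = psi lam β 0 x := by
  rw [H.psi_eq hβ, H.phi_eq]
  congr 1
  refine Finset.sum_congr rfl fun b _ => ?_
  rw [Nat.cast_zero, add_zero, H.branchChar_par, waveWeight, add_zero, ← H.pathWeight_eq]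
  rfl

/-- The element `ψ_l(𝒜^n x - h)` of `L₂(𝔊)`; the index `l = 0` gives `φ(𝒜^n x - h)`. -/
def waveVec (par : ZMod p → ZMod p) (N : ℕ) (lam : ZMod p → ZMod p → ℂ) (l : ZMod p) (n : ℤ)
    (h : Vilenkin p) : L2 p :=
  (1 / p : ℂ) • ∑ b : ZMod p, (waveWeight par N lam l b *
      starRingEnd ℂ (pairing (branchChar par N 0 b (par b + l)) h)) •
    cosetVec (n - 1) (dil (-n) h) (branchChar par N n b (par b + l))

theorem IsParentMap.coeFn_waveVec (H : IsParentMap par N lam) (hβ : IsMaskCoeff lam β) (l : ℕ)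
    (n : ℤ) (h : Vilenkin p) :
    waveVec par N lam l n h =ᵐ[mu p] fun x => psi lam β l (dil n x - h) := by
  rw [waveVec]
  set v := ∑ b : ZMod p, (waveWeight par N lam l b *
      starRingEnd ℂ (pairing (branchChar par N 0 b (par b + l)) h)) •
    cosetVec (n - 1) (dil (-n) h) (branchChar par N n b (par b + l)) with hv
  filter_upwards [Lp.coeFn_smul (1 / p : ℂ) v, coeFn_sum_smul Finset.univ
    (fun b : ZMod p => waveWeight par N lam l b *
      starRingEnd ℂ (pairing (branchChar par N 0 b (par b + l)) h))
    (fun b => coeFn_cosetVec (n - 1) (dil (-n) h) (branchChar par N n b (par b + l)))]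
    with x h1 h2
  rw [h1, Pi.smul_apply, hv, h2, H.psi_eq hβ, smul_eq_mul]
  congr 1
  refine Finset.sum_congr rfl fun b _ => ?_
  rw [cosetChar_dil_sub, dilChar_branchChar, zero_add, mul_assoc, neg_add_eq_sub]

/-! ### Orthogonality relations -/

theorem IsParentMap.inner_waveVec (H : IsParentMap par N lam) (l l' : ZMod p) (n : ℤ)
    {h k : Vilenkin p} (hh : h ∈ H0 p) (hk : k ∈ H0 p) [Decidable (l = l' ∧ h = k)] :
    inner ℂ (waveVec par N lam l n h) (waveVec par N lam l' n k)
      = if l = l' ∧ h = k then (p : ℂ) ^ (-n) else 0 := by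
  classical
  have hp : (p : ℂ) ≠ 0 := Nat.cast_ne_zero.2 (NeZero.ne p)
  rw [waveVec, waveVec, inner_smul_left, inner_smul_right, sum_inner]
  simp only [inner_sum, inner_smul_left, inner_smul_right]
  by_cases hl : l = l'
  · subst hl
    have h1 : ∀ b : ZMod p, ∑ b' : ZMod p, (waveWeight par N lam l b' *
          starRingEnd ℂ (pairing (branchChar par N 0 b' (par b' + l)) k)) *
        (starRingEnd ℂ (waveWeight par N lam l b *
          starRingEnd ℂ (pairing (branchChar par N 0 b (par b + l)) h)) *
        inner ℂ (cosetVec (n - 1) (dil (-n) h) (branchChar par N n b (par b + l)))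
          (cosetVec (n - 1) (dil (-n) k) (branchChar par N n b' (par b' + l))))
        = if k - h ∈ chain p (-1) then
            (p : ℂ) ^ (-(n - 1)) * ZMod.stdAddChar (b * (h - k) (-1)) else 0 := by
      intro b
      rw [Finset.sum_eq_single b]
      · rw [inner_cosetVec_same]
        simp only [dil_sub_mem_chain]
        split_ifs with hc
        · have h2 : starRingEnd ℂ (waveWeight par N lam l b) * waveWeight par N lam l b = 1 := by
            rw [mul_comm, Complex.mul_conj, Complex.normSq_eq_norm_sq, H.norm_waveWeight]; simp
          have hc' : h - k ∈ chain p (-1) := by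
            rw [← neg_sub]; exact neg_mem hc
          have h3 : pairing (branchChar par N 0 b (par b + l)) (h - k)
              = ZMod.stdAddChar (b * (h - k) (-1)) := by
            conv_lhs => rw [eq_single_of_mem_chain hc' (sub_mem_H0 hh hk), pairing_single]
            have := digit_branchChar_pred (par := par) (N := N) 0 b (par b + l)
            rw [zero_sub] at this
            rw [this]
          rw [← h3, pairing_sub, map_mul, Complex.conj_conj]
          linear_combination (p : ℂ) ^ (-(n - 1)) *
            pairing (branchChar par N 0 b (par b + l)) h *
            starRingEnd ℂ (pairing (branchChar par N 0 b (par b + l)) k) * h2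
        · simp
      · intro b' _ hb
        rw [inner_cosetVec_eq_zero le_rfl _ _ le_rfl, mul_zero, mul_zero]
        rw [digit_branchChar_pred, digit_branchChar_pred]
        exact hb.symm
      · simp
    simp only [h1]
    by_cases hc : k - h ∈ chain p (-1)
    · simp only [if_pos hc]
      rw [← Finset.mul_sum, sum_stdAddChar]
      have h4 : (h - k) (-1) = 0 ↔ h = k := by
        constructor
        · intro h0
          have hc' : h - k ∈ chain p (-1) := by
            rw [← neg_sub]; exact neg_mem hc
          have := eq_single_of_mem_chain hc' (sub_mem_H0 hh hk)
          rw [h0, map_zero] at this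
          exact sub_eq_zero.1 this
        · rintro rfl; rw [sub_self]; rfl
      simp only [h4, true_and]
      split_ifs
      · rw [neg_sub, sub_eq_add_neg, zpow_add₀ hp, zpow_one]
        simp
        field_simp
      · simp
    · have : h ≠ k := by rintro rfl; exact hc (by rw [sub_self]; exact zero_mem _)
      simp [hc, this]
  · rw [if_neg (fun h => hl h.1)]
    have h1 : ∀ b b' : ZMod p, inner ℂ
        (cosetVec (n - 1) (dil (-n) h) (branchChar par N n b (par b + l)))
        (cosetVec (n - 1) (dil (-n) k) (branchChar par N n b' (par b' + l'))) = 0 := by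
      intro b b'
      by_cases hb : b = b'
      · subst hb
        refine inner_cosetVec_eq_zero le_rfl _ _ (k := n) (by omega) ?_
        have d := H.digit_branchChar n 0 b
        simp only [Nat.cast_zero, add_zero, Function.iterate_zero, id] at d
        rw [d, d]
        exact fun h => hl (add_left_cancel h)
      · refine inner_cosetVec_eq_zero le_rfl _ _ le_rfl ?_
        rwa [digit_branchChar_pred, digit_branchChar_pred]
    simp [h1]

/-- Wavelets of different scales are orthogonal: the digits `c_{m-1}, c_m` of the characters that
occur satisfy `c_m = par c_{m-1}` at the coarser scale `n < m`, but not at the scale `m`. -/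
theorem IsParentMap.inner_waveVec_of_lt (H : IsParentMap par N lam) (l : ZMod p) {l' : ZMod p}
    (hl' : l' ≠ 0) {n m : ℤ} (hnm : n < m) (h k : Vilenkin p) :
    inner ℂ (waveVec par N lam l n h) (waveVec par N lam l' m k) = 0 := by
  rw [waveVec, waveVec, inner_smul_left, inner_smul_right, sum_inner]
  simp only [inner_sum, inner_smul_left, inner_smul_right]
  have h1 : ∀ b b' : ZMod p, inner ℂ
      (cosetVec (n - 1) (dil (-n) h) (branchChar par N n b (par b + l)))
      (cosetVec (m - 1) (dil (-m) k) (branchChar par N m b' (par b' + l'))) = 0 := by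
    intro b b'
    obtain ⟨r, hr⟩ : ∃ r : ℕ, m - 1 = n + r := ⟨(m - 1 - n).toNat, by omega⟩
    have hr' : m = n + ((r + 1 : ℕ) : ℤ) := by push_cast; omega
    have d1 : digit (branchChar par N n b (par b + l)) (m - 1) = par^[r] (par b + l) := by
      rw [hr, H.digit_branchChar]
    have d2 : digit (branchChar par N n b (par b + l)) m = par^[r + 1] (par b + l) := by
      conv_lhs => rw [hr']
      rw [H.digit_branchChar]
    have d3 := H.digit_branchChar m 0 b' (par b' + l')
    simp only [Nat.cast_zero, add_zero, Function.iterate_zero, id] at d3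
    by_cases hb : par^[r] (par b + l) = b'
    · refine inner_cosetVec_eq_zero (by omega) _ _ (k := m) (by omega) ?_
      rw [d2, d3, Function.iterate_succ_apply', hb]
      exact fun h => hl' (left_eq_add.1 h)
    · refine inner_cosetVec_eq_zero (by omega) _ _ (k := m - 1) le_rfl ?_
      rwa [d1, digit_branchChar_pred]
  simp [h1]

end

section

/-! ### The residues `1, …, p - 1` -/

variable {p : ℕ}

theorem natCast_injective_Icc :
    Function.Injective fun l : Finset.Icc 1 (p - 1) => ((l : ℕ) : ZMod p) := by
  intro l m hlm
  have h1 := Finset.mem_Icc.1 l.2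
  have h2 := Finset.mem_Icc.1 m.2
  have h3 := congrArg ZMod.val hlm
  simp only at h3
  rw [ZMod.val_natCast_of_lt (by omega), ZMod.val_natCast_of_lt (by omega)] at h3
  exact Subtype.ext h3

variable [NeZero p]

theorem natCast_ne_zero_of_mem_Icc (l : Finset.Icc 1 (p - 1)) : ((l : ℕ) : ZMod p) ≠ 0 := by
  have h := Finset.mem_Icc.1 l.2
  have hp := NeZero.pos p
  rw [Ne, ZMod.natCast_eq_zero_iff]
  exact Nat.not_dvd_of_pos_of_lt (by omega) (by omega)

theorem exists_natCast_Icc {l : ZMod p} (hl : l ≠ 0) :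
    ∃ m : Finset.Icc 1 (p - 1), ((m : ℕ) : ZMod p) = l := by
  have h1 := ZMod.val_lt l
  have h2 : l.val ≠ 0 := fun h => hl ((ZMod.val_eq_zero l).1 h)
  exact ⟨⟨l.val, Finset.mem_Icc.2 (by omega)⟩, by simp⟩

variable {par : ZMod p → ZMod p} {N : ℕ} {lam : ZMod p → ZMod p → ℂ} {β : H0s p 2 → ℂ}

/-! ### Completeness -/

theorem waveVec_add_single (l : ZMod p) (n : ℤ) (h : Vilenkin p) (t : ZMod p) :
    waveVec par N lam l n (h + single (-1) t) =
      ∑ b : ZMod p, (1 / p * waveWeight par N lam l b *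
        starRingEnd ℂ (pairing (branchChar par N 0 b (par b + l)) h) *
          ZMod.stdAddChar (-(b * t))) •
        cosetVec (n - 1) (dil (-n) h) (branchChar par N n b (par b + l)) := by
  rw [waveVec, Finset.smul_sum]
  refine Finset.sum_congr rfl fun b _ => ?_
  have h1 : dil (-n) (h + single (-1) t) - dil (-n) h ∈ chain p (n - 1) := by
    rw [map_add, add_sub_cancel_left, dil_single]
    exact single_mem_chain (by omega) t
  have h2 := digit_branchChar_pred (par := par) (N := N) 0 b (par b + l)
  rw [zero_sub] at h2
  rw [cosetVec_congr h1, smul_smul, pairing_add, pairing_single, map_mul, conj_stdAddChar, h2]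
  congr 1
  ring

/-- Summing the translates by `t g_{-1}` against `exp(2πi b t / p)` singles out the digit `b`. -/
theorem IsParentMap.cosetVec_mem_span (H : IsParentMap par N lam) (l : ZMod p) (n : ℤ)
    (a : Vilenkin p) (b : ZMod p) :
    cosetVec (n - 1) a (branchChar par N n b (par b + l)) ∈
      Submodule.span ℂ {v | ∃ h ∈ H0 p, v = waveVec par N lam l n h} := by
  have hp : (p : ℂ) ≠ 0 := Nat.cast_ne_zero.2 (NeZero.ne p)
  obtain ⟨h, hh, hm⟩ := exists_coset_eq n a
  rw [cosetVec_congr (chain_anti p (by omega) hm)]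
  set c := waveWeight par N lam l b *
    starRingEnd ℂ (pairing (branchChar par N 0 b (par b + l)) h) with hc
  have hc0 : c ≠ 0 := by
    rw [← norm_ne_zero_iff, hc, norm_mul, H.norm_waveWeight, RCLike.norm_conj, norm_pairing]
    norm_num
  have hsum : ∑ t : ZMod p, ZMod.stdAddChar (b * t) • waveVec par N lam l n (h + single (-1) t)
      = c • cosetVec (n - 1) (dil (-n) h) (branchChar par N n b (par b + l)) := by
    simp only [waveVec_add_single, Finset.smul_sum, smul_smul]
    rw [Finset.sum_comm]
    simp only [← Finset.sum_smul]
    have h1 : ∀ b' : ZMod p, ∑ t : ZMod p, ZMod.stdAddChar (b * t) *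
        (1 / p * waveWeight par N lam l b' *
          starRingEnd ℂ (pairing (branchChar par N 0 b' (par b' + l)) h) *
          ZMod.stdAddChar (-(b' * t))) = 1 / p * waveWeight par N lam l b' *
          starRingEnd ℂ (pairing (branchChar par N 0 b' (par b' + l)) h) *
          (if b - b' = 0 then (p : ℂ) else 0) := by
      intro b'
      rw [← sum_stdAddChar, Finset.mul_sum]
      refine Finset.sum_congr rfl fun t _ => ?_
      have : t * (b - b') = b * t + -(b' * t) := by ring
      rw [this, AddChar.map_add_eq_mul]
      ring
    simp only [h1]
    rw [Finset.sum_eq_single b]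
    · rw [sub_self, if_pos rfl, hc]
      congr 1
      field_simp
    · intro b' _ hb
      rw [if_neg (sub_ne_zero.2 hb.symm), mul_zero, zero_smul]
    · simp
  have hmem : c • cosetVec (n - 1) (dil (-n) h) (branchChar par N n b (par b + l)) ∈
      Submodule.span ℂ {v | ∃ h ∈ H0 p, v = waveVec par N lam l n h} := by
    rw [← hsum]
    refine Submodule.sum_mem _ fun t _ => Submodule.smul_mem _ _ (Submodule.subset_span ?_)
    exact ⟨_, add_mem_H0 hh (single_mem_H0 t), rfl⟩
  exact (Submodule.smul_mem_iff _ hc0).1 hmem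

theorem inner_eq_zero_of_mem_span {s : Set (L2 p)} {f v : L2 p}
    (hs : ∀ w ∈ s, inner ℂ w f = 0) (hv : v ∈ Submodule.span ℂ s) : inner ℂ v f = 0 := by
  induction hv using Submodule.span_induction with
  | mem w hw => exact hs w hw
  | zero => exact inner_zero_left _
  | add x y _ _ hx hy => rw [inner_add_left, hx, hy, add_zero]
  | smul c x _ hx => rw [inner_smul_left, hx, mul_zero]

theorem IsParentMap.inner_cosetVec_branchChar (H : IsParentMap par N lam) {f : L2 p} {l : ZMod p}
    {n : ℤ} (hf : ∀ h ∈ H0 p, inner ℂ (waveVec par N lam l n h) f = 0) (a : Vilenkin p)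
    (b : ZMod p) : inner ℂ (cosetVec (n - 1) a (branchChar par N n b (par b + l))) f = 0 :=
  inner_eq_zero_of_mem_span (by rintro _ ⟨h, hh, rfl⟩; exact hf h hh)
    (H.cosetVec_mem_span l n a b)

theorem cosetVec_pathChar (n : ℤ) (a : Vilenkin p) (c : ZMod p) :
    cosetVec n a (pathChar par N n c) = (1 / p : ℂ) • ∑ b : ZMod p,
      starRingEnd ℂ (pairing (rademacher p (n - 1) ^ b.val) a) •
        cosetVec (n - 1) a (branchChar par N n b c) := by
  have := cosetVec_succ (n - 1) a (pathChar par N n c)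
  rw [sub_add_cancel] at this
  exact this

/-- A function orthogonal to all `φ(𝒜^n x - h)` and `ψ_l(𝒜^n x - h)` is orthogonal to all
`φ(𝒜^{n+1} x - h)`. -/
theorem IsParentMap.inner_waveVec_succ (H : IsParentMap par N lam) {f : L2 p} {n : ℤ}
    (hf : ∀ l, ∀ h ∈ H0 p, inner ℂ (waveVec par N lam l n h) f = 0) (h : Vilenkin p) :
    inner ℂ (waveVec par N lam 0 (n + 1) h) f = 0 := by
  have h1 : ∀ (a : Vilenkin p) (c : ZMod p), inner ℂ (cosetVec n a (pathChar par N n c)) f = 0 := by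
    intro a c
    rw [cosetVec_pathChar, inner_smul_left, sum_inner, Finset.sum_eq_zero, mul_zero]
    intro b _
    have := H.inner_cosetVec_branchChar (hf (c - par b)) a b
    rw [add_sub_cancel] at this
    rw [inner_smul_left, this, mul_zero]
  rw [waveVec, inner_smul_left, sum_inner, Finset.sum_eq_zero, mul_zero]
  intro b _
  have h2 := H.branchChar_par (n + 1) b
  rw [add_sub_cancel_right] at h2
  rw [inner_smul_left, add_zero, h2, add_sub_cancel_right, h1, mul_zero]

/-- A function orthogonal to all wavelets vanishes. Its inner products with the `p` functions
`1_{a + 𝔊_n} ξ`, where the digits of `ξ` from place `n` on are a path to the root, are averages of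
those for `n - 1`, with `p` terms altogether and weights `1 / p`, while the norms of these functions
grow only by a factor `p^{1/2}` when `n` decreases by `1`. -/
theorem IsParentMap.eq_zero_of_inner_waveVec (H : IsParentMap par N lam) (hp1 : 1 < p) {f : L2 p}
    (hf : ∀ l, l ≠ 0 → ∀ n, ∀ h ∈ H0 p, inner ℂ (waveVec par N lam l n h) f = 0) : f = 0 := by
  classical
  have hp0 : (0 : ℝ) < p := by exact_mod_cast NeZero.pos p
  refine eq_zero_of_inner_cosetVec_one f fun n a => ?_
  set q : ℤ → ZMod p → ℝ := fun n c => ‖inner ℂ (cosetVec n a (pathChar par N n c)) f‖ with hq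
  have hstep : ∀ n c, q n c ≤ 1 / p * ∑ b, if par b = c then q (n - 1) b else 0 := by
    intro n c
    rw [hq]
    simp only
    rw [cosetVec_pathChar, inner_smul_left, norm_mul, sum_inner, RCLike.norm_conj]
    have : ‖(1 / p : ℂ)‖ = 1 / p := by simp
    rw [this]
    refine mul_le_mul_of_nonneg_left ((norm_sum_le _ _).trans (Finset.sum_le_sum fun b _ => ?_))
      (by positivity)
    rw [inner_smul_left, norm_mul, RCLike.norm_conj, RCLike.norm_conj, norm_pairing, one_mul]
    split_ifs with hb
    · rw [← hb, H.branchChar_par]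
    · have h1 := H.inner_cosetVec_branchChar (hf (c - par b) (sub_ne_zero.2 (Ne.symm hb)) n) a b
      rw [add_sub_cancel] at h1
      rw [h1, norm_zero]
  have hstep' : ∀ n, ∑ c, q n c ≤ 1 / p * ∑ b, q (n - 1) b := by
    intro n
    refine (Finset.sum_le_sum fun c _ => hstep n c).trans ?_
    rw [← Finset.mul_sum, Finset.sum_comm]
    simp
  set r : ℝ := Real.sqrt p with hr
  have hr1 : r / p < 1 := by
    rw [div_lt_one hp0, hr, Real.sqrt_lt' hp0]
    have : (1 : ℝ) < p := by exact_mod_cast hp1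
    nlinarith
  have hnorm : ∀ n ξ, ‖cosetVec n a ξ‖ = Real.sqrt ((p : ℝ) ^ (-n)) := fun n ξ => by
    rw [← norm_cosetVec n a ξ, Real.sqrt_sq (norm_nonneg _)]
  have hsqrt : ∀ n : ℤ, Real.sqrt ((p : ℝ) ^ (-(n - 1))) = r * Real.sqrt ((p : ℝ) ^ (-n)) := by
    intro n
    rw [hr, ← Real.sqrt_mul hp0.le, neg_sub, sub_eq_add_neg, zpow_add₀ hp0.ne', zpow_one]
  have hbound : ∀ (D : ℕ) (n : ℤ), ∑ c, q n c ≤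
      (r / p) ^ D * (p * Real.sqrt ((p : ℝ) ^ (-n)) * ‖f‖) := by
    intro D
    induction D with
    | zero =>
      intro n
      rw [pow_zero, one_mul]
      have : ∀ c ∈ Finset.univ, q n c ≤ Real.sqrt ((p : ℝ) ^ (-n)) * ‖f‖ := fun c _ =>
        (norm_inner_le_norm _ _).trans (by rw [hnorm])
      refine (Finset.sum_le_card_nsmul _ _ _ this).trans (le_of_eq ?_)
      rw [Finset.card_univ, ZMod.card, nsmul_eq_mul, mul_assoc]
    | succ D ih =>
      intro n
      refine (hstep' n).trans ?_
      refine (mul_le_mul_of_nonneg_left (ih (n - 1)) (by positivity)).trans (le_of_eq ?_)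
      rw [hsqrt, pow_succ]
      field_simp
  have hzero : ∑ c, q n c ≤ 0 := by
    have h1 := tendsto_pow_atTop_nhds_zero_of_lt_one (r := r / p) (by positivity) hr1
    have h2 := h1.mul_const (p * Real.sqrt ((p : ℝ) ^ (-n)) * ‖f‖)
    rw [zero_mul] at h2
    exact ge_of_tendsto' h2 fun D => hbound D n
  have h0 : q n 0 ≤ 0 :=
    (Finset.single_le_sum (f := fun c => q n c) (fun c _ => norm_nonneg _)
      (Finset.mem_univ 0)).trans hzero
  have h1 := norm_le_zero_iff.1 h0
  rwa [H.pathChar_zero] at h1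

/-! ### The multiresolution spaces -/

theorem IsParentMap.V_eq (H : IsParentMap par N lam) (hβ : IsMaskCoeff lam β) (n : ℤ) :
    V lam n = (Submodule.span ℂ
      {v : L2 p | ∃ h ∈ H0 p, v = waveVec par N lam 0 n h}).topologicalClosure := by
  rw [V]
  congr 3
  ext v
  refine exists_congr fun h => and_congr_right fun _ => ?_
  have hw := H.coeFn_waveVec hβ 0 n h
  simp only [← H.phi_eq_psi hβ, Nat.cast_zero] at hw
  constructor
  · intro hv
    exact Lp.ext (hv.trans hw.symm)
  · rintro rfl
    exact hw

theorem IsParentMap.waveVec_mem_V_one (H : IsParentMap par N lam) (hβ : IsMaskCoeff lam β)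
    (l : ℕ) {h : Vilenkin p} (hh : h ∈ H0 p) : waveVec par N lam l 0 h ∈ V lam 1 := by
  have h1 : waveVec par N lam l 0 h =
      ∑ k : H0s p 2, waveletCoeff β l k • waveVec par N lam 0 1 (dil 1 h + k) := by
    refine Lp.ext ?_
    filter_upwards [H.coeFn_waveVec hβ l 0 h, coeFn_sum_smul Finset.univ (waveletCoeff β l)
      (fun k : H0s p 2 => H.coeFn_waveVec hβ 0 1 (dil 1 h + k))] with x h2 h3
    rw [Nat.cast_zero] at h3
    rw [h2, h3, psi]
    refine Finset.sum_congr rfl fun k _ => ?_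
    rw [H.phi_eq_psi hβ, dil_zero, map_sub, sub_sub]
  rw [h1, H.V_eq hβ]
  refine Submodule.le_topologicalClosure _ (Submodule.sum_mem _ fun k _ =>
    Submodule.smul_mem _ _ (Submodule.subset_span ⟨_, ?_, rfl⟩))
  refine add_mem_H0 (fun n hn => ?_) fun n hn => k.2 n (Or.inl hn)
  rw [dil_coord, hh _ (by omega)]

theorem IsParentMap.V_zero_le (H : IsParentMap par N lam) (hβ : IsMaskCoeff lam β) :
    V lam 0 ≤ V lam 1 := by
  rw [H.V_eq hβ 0]
  refine Submodule.topologicalClosure_minimal _ (Submodule.span_le.2 ?_)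
    (Submodule.isClosed_topologicalClosure _)
  rintro _ ⟨h, hh, rfl⟩
  have := H.waveVec_mem_V_one hβ 0 hh
  rwa [Nat.cast_zero] at this

theorem IsParentMap.mem_V_orthogonal_iff (H : IsParentMap par N lam) (hβ : IsMaskCoeff lam β)
    (n : ℤ) (f : L2 p) :
    f ∈ (V lam n)ᗮ ↔ ∀ h ∈ H0 p, inner ℂ (waveVec par N lam 0 n h) f = 0 := by
  rw [H.V_eq hβ, Submodule.orthogonal_closure, Submodule.mem_orthogonal]
  constructor
  · exact fun h k hk => h _ (Submodule.subset_span ⟨k, hk, rfl⟩)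
  · exact fun h v hv => inner_eq_zero_of_mem_span (by rintro _ ⟨k, hk, rfl⟩; exact h k hk) hv

theorem isClosed_W0 (lam : ZMod p → ZMod p → ℂ) : IsClosed (W0 lam : Set (L2 p)) := by
  rw [W0, Submodule.coe_inf]
  exact (Submodule.isClosed_topologicalClosure _).inter (Submodule.isClosed_orthogonal _)

theorem IsParentMap.exists_hilbertBasis_W0 (H : IsParentMap par N lam)
    (hβ : IsMaskCoeff lam β) :
    ∃ b : HilbertBasis (Finset.Icc 1 (p - 1) × H0 p) ℂ (W0 lam), ∀ l h,
      (b (l, h) : L2 p) = waveVec par N lam (l : ℕ) 0 h := by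
  classical
  have : CompleteSpace (W0 lam) := (isClosed_W0 lam).completeSpace_coe
  have hmem : ∀ q : Finset.Icc 1 (p - 1) × H0 p,
      waveVec par N lam ((q.1 : ℕ) : ZMod p) 0 (q.2 : Vilenkin p) ∈ W0 lam := by
    rintro ⟨l, h⟩
    refine ⟨H.waveVec_mem_V_one hβ l h.2, (H.mem_V_orthogonal_iff hβ 0 _).2 fun k hk => ?_⟩
    rw [H.inner_waveVec _ _ _ hk h.2, if_neg]
    exact fun h' => natCast_ne_zero_of_mem_Icc l h'.1.symm
  let v : Finset.Icc 1 (p - 1) × H0 p → W0 lam := fun q => ⟨_, hmem q⟩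
  have hv : Orthonormal ℂ v := by
    rw [orthonormal_iff_ite]
    rintro ⟨l, h⟩ ⟨m, k⟩
    rw [Submodule.coe_inner, H.inner_waveVec _ _ _ h.2 k.2, neg_zero, zpow_zero]
    refine if_congr ?_ rfl rfl
    rw [Prod.mk.injEq, ← Subtype.ext_iff]
    exact and_congr_left fun _ => natCast_injective_Icc.eq_iff
  have hsp : (Submodule.span ℂ (Set.range v))ᗮ = ⊥ := by
    rw [Submodule.eq_bot_iff]
    rintro ⟨f, hf1, hf0⟩ hf
    rw [Submodule.mem_orthogonal] at hf
    have h1 : f ∈ (V lam 1)ᗮ := by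
      rw [H.mem_V_orthogonal_iff hβ]
      intro h _
      refine H.inner_waveVec_succ (n := 0) (fun l k hk => ?_) h
      by_cases hl : l = 0
      · subst hl
        exact (H.mem_V_orthogonal_iff hβ 0 f).1 hf0 k hk
      · obtain ⟨m, rfl⟩ := exists_natCast_Icc hl
        exact hf _ (Submodule.subset_span ⟨(m, ⟨k, hk⟩), rfl⟩)
    exact Subtype.ext (inner_self_eq_zero.1 ((Submodule.mem_orthogonal _ _).1 h1 f hf1))
  refine ⟨HilbertBasis.mkOfOrthogonalEqBot hv hsp, fun l h => ?_⟩
  rw [HilbertBasis.coe_mkOfOrthogonalEqBot]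

theorem IsParentMap.exists_hilbertBasis (H : IsParentMap par N lam) (hp1 : 1 < p) :
    ∃ b : HilbertBasis (Finset.Icc 1 (p - 1) × ℤ × H0 p) ℂ (L2 p), ∀ l n h,
      b (l, n, h) = (((p : ℝ) ^ ((n : ℝ) / 2) : ℝ) : ℂ) • waveVec par N lam (l : ℕ) n h := by
  classical
  have hp0 : (0 : ℝ) < p := by exact_mod_cast NeZero.pos p
  let v : Finset.Icc 1 (p - 1) × ℤ × H0 p → L2 p := fun q =>
    (((p : ℝ) ^ ((q.2.1 : ℝ) / 2) : ℝ) : ℂ) •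
      waveVec par N lam ((q.1 : ℕ) : ZMod p) q.2.1 (q.2.2 : Vilenkin p)
  have hv : Orthonormal ℂ v := by
    rw [orthonormal_iff_ite]
    rintro ⟨l, n, h⟩ ⟨m, n', k⟩
    simp only [v]
    rw [inner_smul_left, inner_smul_right]
    rcases lt_trichotomy n n' with hn | rfl | hn
    · rw [H.inner_waveVec_of_lt _ (natCast_ne_zero_of_mem_Icc m) hn, mul_zero, mul_zero, if_neg]
      intro h'
      exact hn.ne (congrArg (fun q => q.2.1) h')
    · rw [H.inner_waveVec _ _ _ h.2 k.2]
      have hc : (((l : ℕ) : ZMod p) = ((m : ℕ) : ZMod p) ∧ (h : Vilenkin p) = k) ↔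
          ((l, n, h) : Finset.Icc 1 (p - 1) × ℤ × H0 p) = (m, n, k) := by
        rw [Prod.mk.injEq, Prod.mk.injEq, ← Subtype.ext_iff]
        simp only [true_and]
        exact and_congr_left fun _ => natCast_injective_Icc.eq_iff
      have hpow : (p : ℝ) ^ ((n : ℝ) / 2) * ((p : ℝ) ^ ((n : ℝ) / 2) * (p : ℝ) ^ (-n)) = 1 := by
        rw [← mul_assoc, ← Real.rpow_add hp0, add_halves, Real.rpow_intCast, ← zpow_add₀ hp0.ne',
          add_neg_cancel, zpow_zero]
      rw [if_congr hc rfl rfl]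
      split_ifs
      · rw [Complex.conj_ofReal]
        have := congrArg Complex.ofReal hpow
        rwa [Complex.ofReal_mul, Complex.ofReal_mul, Complex.ofReal_zpow, Complex.ofReal_natCast,
          Complex.ofReal_one] at this
      · simp
    · rw [← inner_conj_symm, H.inner_waveVec_of_lt _ (natCast_ne_zero_of_mem_Icc l) hn, map_zero,
        mul_zero, mul_zero, if_neg]
      intro h'
      exact hn.ne' (congrArg (fun q => q.2.1) h')
  have hsp : (Submodule.span ℂ (Set.range v))ᗮ = ⊥ := by
    rw [Submodule.eq_bot_iff]
    intro f hf
    rw [Submodule.mem_orthogonal] at hf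
    refine H.eq_zero_of_inner_waveVec hp1 fun l hl n h hh => ?_
    obtain ⟨m, rfl⟩ := exists_natCast_Icc hl
    have h1 := hf _ (Submodule.subset_span ⟨(m, n, ⟨h, hh⟩), rfl⟩)
    simp only [v] at h1
    rw [inner_smul_left, Complex.conj_ofReal] at h1
    refine (mul_eq_zero.1 h1).resolve_left ?_
    exact Complex.ofReal_ne_zero.2 (Real.rpow_pos_of_pos hp0 _).ne'
  refine ⟨HilbertBasis.mkOfOrthogonalEqBot hv hsp, fun l n h => ?_⟩
  rw [HilbertBasis.coe_mkOfOrthogonalEqBot]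

end

end VilenkinWavelet

end

theorem theorem5p1 (p : ℕ) [Fact p.Prime] (T : SimpleGraph (ZMod p)) (hT : T.IsTree)
    (lam : ZMod p → ZMod p → ℂ) (hlam : VilenkinWavelet.IsTreeSequence T lam) :
    (∃! β : VilenkinWavelet.H0s p 2 → ℂ, VilenkinWavelet.IsMaskCoeff lam β) ∧
    ∀ β : VilenkinWavelet.H0s p 2 → ℂ, VilenkinWavelet.IsMaskCoeff lam β →
      VilenkinWavelet.V lam 0 ≤ VilenkinWavelet.V lam 1 ∧
      (∃ b : HilbertBasis (Finset.Icc 1 (p - 1) × VilenkinWavelet.H0 p) ℂ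
          (VilenkinWavelet.W0 lam),
        ∀ (l : Finset.Icc 1 (p - 1)) (h : VilenkinWavelet.H0 p),
          ((b (l, h) : VilenkinWavelet.L2 p) : VilenkinWavelet.Vilenkin p → ℂ)
            =ᵐ[VilenkinWavelet.mu p]
          fun x => VilenkinWavelet.psi lam β l (x - h)) ∧
      (∃ b : HilbertBasis (Finset.Icc 1 (p - 1) × ℤ × VilenkinWavelet.H0 p) ℂ
          (VilenkinWavelet.L2 p),
        ∀ (l : Finset.Icc 1 (p - 1)) (n : ℤ) (h : VilenkinWavelet.H0 p),
          ((b (l, n, h) : VilenkinWavelet.L2 p) : VilenkinWavelet.Vilenkin p → ℂ)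
            =ᵐ[VilenkinWavelet.mu p]
          fun x => (((p : ℝ) ^ ((n : ℝ) / 2) : ℝ) : ℂ) *
            VilenkinWavelet.psi lam β l (VilenkinWavelet.dil n x - h)) := by
  obtain ⟨par, N, H⟩ := hlam.exists_isParentMap hT
  refine ⟨VilenkinWavelet.existsUnique_isMaskCoeff lam, fun β hβ => ⟨H.V_zero_le hβ, ?_, ?_⟩⟩
  · obtain ⟨b, hb⟩ := H.exists_hilbertBasis_W0 hβ
    refine ⟨b, fun l h => ?_⟩
    rw [hb]
    simpa only [VilenkinWavelet.dil_zero] using H.coeFn_waveVec hβ l 0 h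
  · obtain ⟨b, hb⟩ := H.exists_hilbertBasis (Fact.out : p.Prime).one_lt
    refine ⟨b, fun l n h => ?_⟩
    rw [hb]
    filter_upwards [H.coeFn_waveVec hβ l n h, Lp.coeFn_smul
      (((p : ℝ) ^ ((n : ℝ) / 2) : ℝ) : ℂ) (VilenkinWavelet.waveVec par N lam (l : ℕ) n h)]
      with x h1 h2
    rw [h2, Pi.smul_apply, h1, smul_eq_mul]
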